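/- A prudent walk is a self-avoiding nearest-neighbour walk on the square lattice $\mathbb{Z}^2$ starting at $(0,0)$ which never steps towards an already visited vertex (no earlier vertex lies on the ray from the current vertex in the direction of the step). A prudent polygon is a prudent walk with more than one step whose last vertex is adjacent to $(0,0)$; it is closed by the root edge between these two vertices, its half-perimeter is half the number of its edges, including the root edge, and its box is its minimal bounding rectangle. Let $\mathcal F$ be the class of prudent polygons which end in $(1,0)$ and reach this vertex via $(1,1)$ (clockwise). Let $\mathcal G\subseteq\mathcal F$ consist of the unit square together with those polygons in $\mathcal F$ which are obtained by attaching a piece (a collection of unit cells) to the top side of the top row of a polygon in $\mathcal F$, or of the degenerate polygon consisting of the root edge from $(0,0)$ to $(1,0)$ only, in such a way that the top side of the box is shifted by one unit, the left side by at least one unit and the bottom side by an arbitrary number $\ge 0$ of units. Let $\mathcal H\subseteq\mathcal G$ consist of those polygons in $\mathcal G$ which are obtained by glueing a piece to the left of the leftmost column of a polygon in $\mathcal G$, shifting the left side of the box by exactly one unit, the bottom side by at least one unit and the top side not at all. Here a piece is attached in such a way that the boundary walk of the new polygon follows the boundary walk of the old one until the latter reaches its top side (respectively, its left side). Let $F(u,w,x)=F(t,u,w,x)$,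 $G(u,w,x)=G(t,u,w,x)$ and $H(u,w,x)=H(t,u,w,x)$ be the generating functions, in $\mathbb{Z}[[t,u,w,x]]$, of $\mathcal F$, $\mathcal G$ and $\mathcal H$, where $t$ marks the half-perimeter and - in $F$, $u$ marks the length of the top row, $w$ the distance of the top left corner of the top row to the top left corner of the box, and $x$ the height of the box; - in $G$, $u$ marks the length of the leftmost column, $w$ the distance of its lower left corner to the bottom left corner of the box, and $x$ the width of the box; - in $H$, $u$ marks the length of the bottom row, $w$ the distance minus one of its lower right corner to the bottom right corner of the box, and $x$ the height of the box. Then for $X=F,G,H$, as an identity of formal power series (all quotients being formal power series), $$X(u,w,x)=\frac{tux\,\bigl(X(w,w,x)-X(u,w,x)\bigr)}{w-u}+\frac{t^2ux\,\bigl(X(u,w,x)-X(u,ut,x)\bigr)}{w-ut}+I_X(u,w,x),$$ where $$I_F(u,w,x)=G(x,x,u),\qquad I_G(u,w,x)=t^2ux+t^2ux\,F(x,xt,w)+x\,H(x,x,u),\qquad I_H(u,w,x)=t^2ux\,w^{-1}\,G(x,xt,w).$$ -/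

import Mathlib

noncomputable section

namespace Prudent

/-- Vertices of the square lattice. -/
abbrev Vertex := ℤ × ℤ

/-- Nearest neighbours on the square lattice. -/
def Adjacent (p q : Vertex) : Prop :=
  q - p = (1, 0) ∨ q - p = (-1, 0) ∨ q - p = (0, 1) ∨ q - p = (0, -1)

/-- Prudent walks, given by the list of their successive vertices: self-avoiding nearest neighbour
walks starting at the origin which never step towards an already occupied vertex, i.e. no vertex
visited so far lies on the ray from the current vertex in the direction of the next step. -/
structure IsPrudentWalk (l : List Vertex) : Prop where
  start : l.head? = some (0, 0)
  chain : l.IsChain Adjacent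
  selfAvoiding : l.Nodup
  prudent : ∀ (i : ℕ) (h : i + 1 < l.length) (k : ℕ), 0 < k →
    l[i] + k • (l[i + 1] - l[i]) ∉ l.take (i + 1)

/-- Prudent polygons: prudent walks whose last vertex is adjacent to their first vertex, single
edges excluded. The closing edge is not part of the list. -/
structure IsPrudentPolygon (l : List Vertex) : Prop where
  walk : IsPrudentWalk l
  closed : ∃ v, l.getLast? = some v ∧ Adjacent v (0, 0)
  notEdge : 2 < l.length

/-- Half the number of edges of the polygon. A polygon has as many edges (including the closing
one) as vertices, and this number is even. -/
def halfPerimeter (l : List Vertex) : ℕ := l.length / 2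

/-! The sides of the box (minimal bounding rectangle) of a walk. The walks start at the origin,
so `0` is always among the coordinates. -/

def leftSide (l : List Vertex) : ℤ := (l.map Prod.fst).foldr min 0
def rightSide (l : List Vertex) : ℤ := (l.map Prod.fst).foldr max 0
def bottomSide (l : List Vertex) : ℤ := (l.map Prod.snd).foldr min 0
def topSide (l : List Vertex) : ℤ := (l.map Prod.snd).foldr max 0

def boxWidth (l : List Vertex) : ℤ := rightSide l - leftSide l
def boxHeight (l : List Vertex) : ℤ := topSide l - bottomSide l

/-- Abscissa of the top left corner of the top row: the least abscissa of a vertex on the top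
side of the box. -/
def topRowLeft (l : List Vertex) : ℤ :=
  ((l.filter (fun v => v.2 = topSide l)).map Prod.fst).foldr min (rightSide l)

/-- Ordinate of the lower left corner of the leftmost column: the least ordinate of a vertex on
the left side of the box. -/
def leftColumnBottom (l : List Vertex) : ℤ :=
  ((l.filter (fun v => v.1 = leftSide l)).map Prod.snd).foldr min (topSide l)

/-- Abscissa of the lower right corner of the bottom row: the greatest abscissa of a vertex on
the bottom side of the box. -/
def bottomRowRight (l : List Vertex) : ℤ :=
  ((l.filter (fun v => v.2 = bottomSide l)).map Prod.fst).foldr max (leftSide l)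

/-- The class `𝓕`: prudent polygons ending in `(1, 0)` which reach this vertex via `(1, 1)`. -/
def classF : Set (List Vertex) :=
  {l | IsPrudentPolygon l ∧ [(1, 1), (1, 0)] <:+ l}

/-- The unit square with vertices `(0, 0)` and `(1, 1)`. -/
def unitSquare : List Vertex := [(0, 0), (0, 1), (1, 1), (1, 0)]

/-- The degenerate polygon which consists of the root edge only and encloses no cell. -/
def rootEdge : List Vertex := [(0, 0), (1, 0)]

/-- The boundary walk from the origin up to the top left corner of the top row. -/
def untilTop (l : List Vertex) : List Vertex :=
  l.takeWhile (fun v => v.2 < topSide l) ++ [(topRowLeft l, topSide l)]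

/-- The boundary walk from the origin up to the lower left corner of the leftmost column. -/
def untilLeft (l : List Vertex) : List Vertex :=
  l.takeWhile (fun v => leftSide l < v.1) ++ [(leftSide l, leftColumnBottom l)]

/-- `l` is obtained by attaching a piece on top of `k`, i.e. to the top side of the top row of
`k`: the boundary walk of `l` follows the one of `k` until this reaches its top side. (On the
other end both walks run straight down the line of abscissa `1` to `(1, 0)`.) -/
def AttachedOnTop (k l : List Vertex) : Prop := untilTop k <+: l

/-- `l` is obtained by glueing a piece to the left of the leftmost column of `k`: the boundary
walk of `l` follows the one of `k` until this reaches its left side. -/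
def AttachedOnLeft (k l : List Vertex) : Prop := untilLeft k <+: l

/-- The class `𝓖`: the unit square, and the polygons in `𝓕` obtained by attaching a piece on top
of a polygon in `𝓕` or of the root edge, such that the top side of the box is shifted by one unit,
the left side by at least one unit and the bottom side by an arbitrary number of units. -/
def classG : Set (List Vertex) :=
  {l | l ∈ classF ∧ (l = unitSquare ∨ ∃ k, (k ∈ classF ∨ k = rootEdge) ∧ AttachedOnTop k l ∧
    topSide l = topSide k + 1 ∧ leftSide l ≤ leftSide k - 1 ∧ bottomSide l ≤ bottomSide k)}

/-- The class `𝓗`: the polygons in `𝓖` obtained by glueing a piece to the left of the leftmost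
column of a polygon in `𝓖`, such that the left side of the box is shifted by exactly one unit, the
bottom side by at least one unit, and the top side not at all. -/
def classH : Set (List Vertex) :=
  {l | l ∈ classG ∧ ∃ k ∈ classG, AttachedOnLeft k l ∧
    leftSide l = leftSide k - 1 ∧ bottomSide l ≤ bottomSide k - 1 ∧ topSide l = topSide k}

/-- Formal power series in the four variables `t, u, w, x`. -/
abbrev Series := MvPowerSeries (Fin 4) ℤ

def t : Series := MvPowerSeries.X 0
def u : Series := MvPowerSeries.X 1
def w : Series := MvPowerSeries.X 2
def x : Series := MvPowerSeries.X 3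

/-- The generating function of a class of polygons, where `t` marks the half-perimeter and
`u, w, x` mark the parameters `a, b, c`. (For a given half-perimeter there are only finitely many
walks.) -/
def genFun (C : Set (List Vertex)) (a b c : List Vertex → ℤ) : Series := fun m =>
  (({l | l ∈ C ∧ halfPerimeter l = m 0 ∧ a l = (m 1 : ℤ) ∧ b l = (m 2 : ℤ) ∧
    c l = (m 3 : ℤ)}.ncard : ℕ) : ℤ)

/-- `F`: `u` marks the length of the top row, `w` the distance of its top left corner to the one
of the box, `x` the height of the box. -/
def F : Series :=
  genFun classF (fun l => rightSide l - topRowLeft l) (fun l => topRowLeft l - leftSide l)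
    boxHeight

/-- `G`: `u` marks the length of the leftmost column, `w` the distance of its lower left corner to
the one of the box, `x` the width of the box. -/
def G : Series :=
  genFun classG (fun l => topSide l - leftColumnBottom l)
    (fun l => leftColumnBottom l - bottomSide l) boxWidth

/-- `H`: `u` marks the length of the bottom row, `w` the distance minus one of its lower right
corner to the one of the box, `x` the height of the box. -/
def H : Series :=
  genFun classH (fun l => bottomRowRight l - leftSide l)
    (fun l => rightSide l - bottomRowRight l - 1) boxHeight

/-- The substituted series `X(t, a, b, c)`. -/
def eval (X a b c : Series) : Series := MvPowerSeries.subst ![t, a, b, c] X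

/-- The functional equation
`X = t u x (X(w,w,x) - X(u,w,x)) / (w - u) + t² u x (X(u,w,x) - X(u,ut,x)) / (w - ut) + I`.
The quotients `D₁` and `D₂` are formal power series; they are unique, as the ring of formal power
series has no zero divisors. -/
def FunctionalEquation (X I : Series) : Prop :=
  ∃ D₁ D₂ : Series,
    (w - u) * D₁ = eval X w w x - eval X u w x ∧
    (w - u * t) * D₂ = eval X u w x - eval X u (u * t) x ∧
    eval X u w x = t * u * x * D₁ + t ^ 2 * u * x * D₂ + I

end Prudent

end

namespace Prudent

open MvPowerSeries Topology
open scoped MvPowerSeries.WithPiTopology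

/-! The boundary walk of a polygon in `classF` has nonpositive abscissas until it follows its top
row to some `(1, T)` and descends to `(1, 0)`. It is therefore determined by its part up to its
first vertex on the top side. Since a prudent walk always ends on the boundary of its box
(`IsPrudentWalk.not_interior`), that part is a succession of records: vertices at which a new top,
left or bottom coordinate is attained. Between two records the walk runs straight along the side it
has reached, then either steps outwards off that side or turns a corner of the box. These moves are
the constructors of `RecordWalk`.

Completing a record walk clockwise along its box turns records on the top, left and bottom side into
exactly the polygons of `classF`, `classG` and `classH` (`Record.range_polygon_top`,
`Record.range_polygon_left`, `Record.range_polygon_bottom`), injectively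
(`Record.polygon_injective`). A record walk stops at its first vertex on or beyond a given line, so
the last move leading to it is unique (`EndsAtFirst.eq`, `EndsAtFirst.not_prefix`).

A move that stays on the same side adds a row or column. If the old one has length `a` and distance
`b` to the corner, the new length is any of `1, ..., a + b`; the half-perimeter grows by one, plus
the excess over `a` if there is one. Summing over the lengths up to `a` and over the longer ones
gives two geometric sums, which are the two quotients (`functionalEquation_of_bijective`). The
corner moves, together with the unit square, give the terms `I_X`; their weights are read off from
`Record.halfPerimeter_top`, `Record.halfPerimeter_left` and `Record.halfPerimeter_bottom`. -/

theorem hasSum_of_eq {S : Type*} {f g : S → Series} {X : Series} (h : HasSum f X)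
    (hfg : ∀ s, f s = g s) : HasSum g X :=
  funext hfg ▸ h

/-! ### Generating functions as infinite sums, and the abstract functional equation -/

/-- The contribution of a single object to a substituted generating function. -/
noncomputable def weight (A B C : Series) (n a b c : ℕ) : Series := t ^ n * (A ^ a * B ^ b * C ^ c)

theorem coeff_t_pow_mul_of_lt {n : ℕ} {m : Fin 4 →₀ ℕ} (h : m 0 < n) (g : Series) :
    coeff m (t ^ n * g) = 0 := by
  have : (t : Series) ^ n = monomial (Finsupp.single 0 n) 1 := MvPowerSeries.X_pow_eq 0 n
  rw [this, coeff_monomial_mul, if_neg]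
  intro h'
  have := h' 0
  simp at this
  omega

/-- A fixed monomial bounds the exponent of `t`, so only finitely many terms contribute to each
coefficient, whatever the other factors are. -/
theorem summable_t_pow_mul {S : Type*} {n : S → ℕ} (hn : ∀ N, {s | n s = N}.Finite)
    (g : S → Series) : Summable fun s => t ^ n s * g s := by
  rw [WithPiTopology.summable_iff_summable_coeff]
  intro m
  apply summable_of_hasFiniteSupport
  have : {s | n s ≤ m 0}.Finite := by
    have h : {s | n s ≤ m 0} = ⋃ N ∈ Finset.range (m 0 + 1), {s | n s = N} := by
      ext s; simp
    rw [h]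
    exact Set.Finite.biUnion (Finset.finite_toSet _) fun N _ => hn N
  refine this.subset fun s hs => ?_
  by_contra h
  exact hs (coeff_t_pow_mul_of_lt (by simpa using h) _)

theorem weight_eq_monomial (n a b c : ℕ) :
    weight u w x n a b c =
      monomial (Finsupp.single 0 n + (Finsupp.single 1 a + Finsupp.single 2 b
        + Finsupp.single 3 c)) (1 : ℤ) := by
  simp only [weight, t, u, w, x, MvPowerSeries.X_pow_eq, monomial_mul_monomial, mul_one]

theorem hasSum_weight {S : Type*} {n a b c : S → ℕ} (hn : ∀ N, {s | n s = N}.Finite)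
    {X : Series} (hX : ∀ m, X m =
      (({s | n s = m 0 ∧ a s = m 1 ∧ b s = m 2 ∧ c s = m 3}.ncard : ℕ) : ℤ)) :
    HasSum (fun s => weight u w x (n s) (a s) (b s) (c s)) X := by
  classical
  rw [WithPiTopology.hasSum_iff_hasSum_coeff]
  intro m
  have hfin : {s | n s = m 0 ∧ a s = m 1 ∧ b s = m 2 ∧ c s = m 3}.Finite :=
    (hn (m 0)).subset fun s hs => hs.1
  have hc : coeff m X = ∑ s ∈ hfin.toFinset, (1 : ℤ) := by
    rw [Finset.sum_const, ← Set.ncard_eq_toFinset_card _ hfin, nsmul_one]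
    exact hX m
  have key : ∀ s, m = Finsupp.single 0 (n s) + (Finsupp.single 1 (a s) + Finsupp.single 2 (b s)
        + Finsupp.single 3 (c s)) ↔ n s = m 0 ∧ a s = m 1 ∧ b s = m 2 ∧ c s = m 3 := by
    intro s
    constructor
    · intro h
      rw [h]
      simp
    · rintro ⟨h0, h1, h2, h3⟩
      ext i
      fin_cases i <;> simp [*]
  rw [hc]
  have : ∀ s, coeff m (weight u w x (n s) (a s) (b s) (c s)) =
      if n s = m 0 ∧ a s = m 1 ∧ b s = m 2 ∧ c s = m 3 then 1 else 0 := by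
    intro s
    rw [weight_eq_monomial, coeff_monomial]
    exact if_congr (key s) rfl rfl
  simp only [this]
  rw [← Finset.sum_congr rfl fun s hs => if_pos (c := n s = m 0 ∧ a s = m 1 ∧ b s = m 2 ∧ c s = m 3)
    (e := (0 : ℤ)) (by simpa using hs)]
  exact hasSum_sum_of_ne_finset_zero fun s hs => if_neg (by simpa using hs)

theorem hasSubst_of_constantCoeff {A B C : Series} (hA : constantCoeff A = 0)
    (hB : constantCoeff B = 0) (hC : constantCoeff C = 0) : HasSubst ![t, A, B, C] := by
  apply hasSubst_of_constantCoeff_zero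
  intro i
  fin_cases i
  · exact MvPowerSeries.constantCoeff_X 0
  · exact hA
  · exact hB
  · exact hC

theorem subst_weight {A B C : Series} (h : HasSubst ![t, A, B, C]) (n a b c : ℕ) :
    subst ![t, A, B, C] (weight u w x n a b c) = weight A B C n a b c := by
  have h0 := subst_X (R := ℤ) h 0
  have h1 := subst_X (R := ℤ) h 1
  have h2 := subst_X (R := ℤ) h 2
  have h3 := subst_X (R := ℤ) h 3
  rw [weight, subst_mul h, subst_mul h, subst_mul h, subst_pow h, subst_pow h, subst_pow h,
    subst_pow h]
  exact congr_arg₂ _ (congr_arg (· ^ n) h0) (congr_arg₂ _ (congr_arg₂ _ (congr_arg (· ^ a) h1)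
    (congr_arg (· ^ b) h2)) (congr_arg (· ^ c) h3))

/-- Substitution of series without constant term is continuous, hence may be carried out term by
term. -/
theorem hasSum_eval {S : Type*} {n a b c : S → ℕ} {X : Series}
    (hX : HasSum (fun s => weight u w x (n s) (a s) (b s) (c s)) X)
    {A B C : Series} (hA : constantCoeff A = 0)
    (hB : constantCoeff B = 0) (hC : constantCoeff C = 0) :
    HasSum (fun s => weight A B C (n s) (a s) (b s) (c s)) (eval X A B C) := by
  have h := hasSubst_of_constantCoeff hA hB hC
  -- Continuity of substitution is formulated with a uniform structure on the coefficients; the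
  -- discrete one is used.
  let _ : UniformSpace ℤ := ⊥
  have _ : DiscreteUniformity ℤ := ⟨rfl⟩
  have hc : Continuous (substAlgHom (R := ℤ) h) := by
    have := MvPowerSeries.continuous_subst (R := ℤ) h
    rwa [coe_substAlgHom]
  have := hX.map (substAlgHom (R := ℤ) h) hc
  rw [coe_substAlgHom] at this
  unfold eval
  convert this using 1
  ext1 s
  exact (subst_weight h _ _ _ _).symm

theorem constantCoeff_u : constantCoeff u = 0 := MvPowerSeries.constantCoeff_X 1
theorem constantCoeff_w : constantCoeff w = 0 := MvPowerSeries.constantCoeff_X 2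
theorem constantCoeff_x : constantCoeff x = 0 := MvPowerSeries.constantCoeff_X 3

/-- The two ways to add a row to an object with statistics `n, a, b, c`: either the new row has
length at most `a`, or it is longer and costs extra half-perimeter. -/
theorem sum_weight_step (n a b c : ℕ) :
    ∑ i : Fin (a + b), weight u w x (n + 1 + (i + 1 - a)) (i + 1) (a + b - 1 - i) (c + 1) =
      t * u * x * (t ^ n * (w ^ b * x ^ c * ∑ j ∈ Finset.range a, u ^ j * w ^ (a - 1 - j))) +
      t ^ 2 * u * x *
        (t ^ n * (u ^ a * x ^ c * ∑ j ∈ Finset.range b, (u * t) ^ j * w ^ (b - 1 - j))) := by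
  rw [Fin.sum_univ_eq_sum_range
    (fun i => weight u w x (n + 1 + (i + 1 - a)) (i + 1) (a + b - 1 - i) (c + 1)) (a + b),
    Finset.sum_range_add]
  simp only [Finset.mul_sum]
  congr 1
  · refine Finset.sum_congr rfl fun j hj => ?_
    have hj := Finset.mem_range.1 hj
    rw [show j + 1 - a = 0 by omega, show a + b - 1 - j = b + (a - 1 - j) by omega, weight]
    ring
  · refine Finset.sum_congr rfl fun j hj => ?_
    have hj := Finset.mem_range.1 hj
    rw [show a + j + 1 - a = j + 1 by omega, show a + b - 1 - (a + j) = b - 1 - j by omega, weight]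
    ring

/-- A class of objects satisfies the functional equation if every object arises in a unique way
either from another one by adding a row, or as one of the initial objects enumerated by `R`. -/
theorem functionalEquation_of_bijective {S R : Type*} {n a b c : S → ℕ}
    (hn : ∀ N, {s | n s = N}.Finite) {X I : Series}
    (hX : HasSum (fun s => weight u w x (n s) (a s) (b s) (c s)) X)
    (step : (Σ s, Fin (a s + b s)) → S) (init : R → S)
    (hbij : Function.Bijective (Sum.elim step init))
    (hstep : ∀ s i, n (step ⟨s, i⟩) = n s + 1 + (i + 1 - a s) ∧ a (step ⟨s, i⟩) = i + 1 ∧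
      b (step ⟨s, i⟩) = a s + b s - 1 - i ∧ c (step ⟨s, i⟩) = c s + 1)
    (hI : HasSum (fun r => weight u w x (n (init r)) (a (init r)) (b (init r)) (c (init r))) I) :
    FunctionalEquation X I := by
  have hut : constantCoeff (u * t) = 0 := by rw [map_mul, constantCoeff_u, zero_mul]
  have huwx : HasSum (fun s => weight u w x (n s) (a s) (b s) (c s)) (eval X u w x) :=
    hasSum_eval hX constantCoeff_u constantCoeff_w constantCoeff_x
  obtain ⟨D₁, hD₁⟩ := summable_t_pow_mul hn fun s =>
    w ^ b s * x ^ c s * ∑ j ∈ Finset.range (a s), u ^ j * w ^ (a s - 1 - j)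
  obtain ⟨D₂, hD₂⟩ := summable_t_pow_mul hn fun s =>
    u ^ a s * x ^ c s * ∑ j ∈ Finset.range (b s), (u * t) ^ j * w ^ (b s - 1 - j)
  refine ⟨D₁, D₂, ?_, ?_, ?_⟩
  rotate_left 2
  · have hsum : HasSum (fun s : (Σ s, Fin (a s + b s)) ⊕ R =>
        weight u w x (n (Sum.elim step init s)) (a (Sum.elim step init s))
          (b (Sum.elim step init s)) (c (Sum.elim step init s))) (eval X u w x) :=
      (Equiv.ofBijective _ hbij).hasSum_iff.2 huwx
    have hinl := (hsum.summable.comp_injective Sum.inl_injective).hasSum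
    have h := (hinl.sum hI).unique hsum
    rw [← h]
    congr 1
    -- Group the row extensions by the object they extend; each group is finite and is evaluated by
    -- `sum_weight_step`.
    refine (hinl.sigma fun s => hasSum_fintype _).unique ?_
    refine hasSum_of_eq ((hD₁.mul_left (t * u * x)).add (hD₂.mul_left (t ^ 2 * u * x)))
      fun s => ?_
    rw [← sum_weight_step]
    refine Finset.sum_congr rfl fun i _ => ?_
    obtain ⟨h1, h2, h3, h4⟩ := hstep s i
    simp only [Function.comp, Sum.elim_inl, h1, h2, h3, h4]
  · refine (hD₁.mul_left (w - u)).unique ?_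
    refine hasSum_of_eq ((hasSum_eval hX constantCoeff_w constantCoeff_w constantCoeff_x).sub huwx)
      fun s => ?_
    -- The factor `w - u` collapses the geometric sum to `w ^ a - u ^ a`, up to the remaining
    -- factors `w ^ b * x ^ c`.
    have := (Commute.all u w).geom_sum₂_mul (a s)
    simp only [weight]
    linear_combination (t ^ n s * (w ^ b s * x ^ c s)) * this
  · refine (hD₂.mul_left (w - u * t)).unique ?_
    refine hasSum_of_eq (huwx.sub (hasSum_eval hX constantCoeff_u hut constantCoeff_x))
      fun s => ?_
    have := (Commute.all (u * t) w).geom_sum₂_mul (b s)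
    simp only [weight]
    linear_combination (t ^ n s * (u ^ a s * x ^ c s)) * this

/-! ### Prudent steps, and the position of the endpoint of a prudent walk -/

theorem isPrudentWalk_concat_iff {a : List Vertex} {e v : Vertex} :
    IsPrudentWalk (a ++ [e] ++ [v]) ↔ IsPrudentWalk (a ++ [e]) ∧ Adjacent e v ∧
      ∀ k : ℕ, 0 < k → e + k • (v - e) ∉ a ++ [e] := by
  have e1 : (a ++ [e] ++ [v])[a.length]'(by simp) = e := by simp
  have e2 : (a ++ [e] ++ [v])[a.length + 1]'(by simp) = v := by simp
  have e3 : (a ++ [e] ++ [v]).take (a.length + 1) = a ++ [e] := by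
    rw [List.take_append_of_le_length (by simp), List.take_of_length_le (by simp)]
  constructor
  · rintro ⟨h1, h2, h3, h4⟩
    refine ⟨⟨?_, ?_, ?_, ?_⟩, ?_, ?_⟩
    · cases a <;> simpa using h1
    · exact h2.left_of_append
    · exact (List.nodup_append.1 h3).1
    · intro i hi k hk
      have := h4 i (by rw [List.length_append]; omega) k hk
      rw [List.getElem_append_left (by omega), List.getElem_append_left hi,
        List.take_append_of_le_length (by omega)] at this
      exact this
    · rw [List.append_assoc, List.isChain_append] at h2
      simpa using h2.2.1
    · intro k hk
      have := h4 a.length (by simp) k hk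
      rwa [e1, e2, e3] at this
  · rintro ⟨⟨h1, h2, h3, h4⟩, h5, h6⟩
    -- The first point of the ray is the new vertex itself, so prudence already implies
    -- self-avoidance.
    have hv : v ∉ a ++ [e] := by simpa using h6 1 one_pos
    refine ⟨?_, ?_, ?_, ?_⟩
    · cases a <;> simpa using h1
    · rw [List.isChain_append]
      exact ⟨h2, by simp, by simpa using h5⟩
    · rw [List.nodup_append]
      exact ⟨h3, by simp, fun b hb c hc => by rintro rfl; simp at hc; exact hv (hc ▸ hb)⟩
    · intro i hi k hk
      rcases lt_or_ge (i + 1) (a ++ [e]).length with h | h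
      · rw [List.getElem_append_left (by omega), List.getElem_append_left h,
          List.take_append_of_le_length (by omega)]
        exact h4 i h k hk
      · have : i = a.length := by simp at h hi; omega
        subst this
        rw [e1, e2, e3]
        exact h6 k hk

/-- The walk `l`, ending in `e`, makes a prudent step to `v`. -/
def PrudentStep (l : List Vertex) (e v : Vertex) : Prop :=
  (v = (e.1 + 1, e.2) ∧ ∀ z ∈ l, z.2 = e.2 → z.1 ≤ e.1) ∨
  (v = (e.1 - 1, e.2) ∧ ∀ z ∈ l, z.2 = e.2 → e.1 ≤ z.1) ∨
  (v = (e.1, e.2 + 1) ∧ ∀ z ∈ l, z.1 = e.1 → z.2 ≤ e.2) ∨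
  (v = (e.1, e.2 - 1) ∧ ∀ z ∈ l, z.1 = e.1 → e.2 ≤ z.2)

theorem adjacent_and_ray_iff {l : List Vertex} {e v : Vertex} :
    (Adjacent e v ∧ ∀ k : ℕ, 0 < k → e + k • (v - e) ∉ l) ↔ PrudentStep l e v := by
  obtain ⟨p, q⟩ := e
  obtain ⟨p', q'⟩ := v
  have key : ∀ (d : ℤ × ℤ) (P : ℤ × ℤ → Prop),
      (∀ z : ℤ × ℤ, ¬ P z ↔ ∃ k : ℕ, 0 < k ∧ (p, q) + k • d = z) →
      ((∀ k : ℕ, 0 < k → (p, q) + k • d ∉ l) ↔ ∀ z ∈ l, P z) := by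
    intro d P hP
    constructor
    · intro h z hz
      by_contra hz'
      obtain ⟨k, hk, rfl⟩ := (hP z).1 hz'
      exact h k hk hz
    · intro h k hk hl
      exact (hP _).2 ⟨k, hk, rfl⟩ (h _ hl)
  have k1 := key (1, 0) (fun z => z.2 = q → z.1 ≤ p) (by
    rintro ⟨z1, z2⟩
    simp only [Prod.smul_mk, Prod.mk_add_mk, Prod.mk.injEq, nsmul_eq_mul]
    refine ⟨fun h => ⟨(z1 - p).toNat, ?_⟩, ?_⟩
    · push Not at h; omega
    · rintro ⟨k, h⟩; push Not; omega)
  have k2 := key (-1, 0) (fun z => z.2 = q → p ≤ z.1) (by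
    rintro ⟨z1, z2⟩
    simp only [Prod.smul_mk, Prod.mk_add_mk, Prod.mk.injEq, nsmul_eq_mul]
    refine ⟨fun h => ⟨(p - z1).toNat, ?_⟩, ?_⟩
    · push Not at h; omega
    · rintro ⟨k, h⟩; push Not; omega)
  have k3 := key (0, 1) (fun z => z.1 = p → z.2 ≤ q) (by
    rintro ⟨z1, z2⟩
    simp only [Prod.smul_mk, Prod.mk_add_mk, Prod.mk.injEq, nsmul_eq_mul]
    refine ⟨fun h => ⟨(z2 - q).toNat, ?_⟩, ?_⟩
    · push Not at h; omega
    · rintro ⟨k, h⟩; push Not; omega)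
  have k4 := key (0, -1) (fun z => z.1 = p → q ≤ z.2) (by
    rintro ⟨z1, z2⟩
    simp only [Prod.smul_mk, Prod.mk_add_mk, Prod.mk.injEq, nsmul_eq_mul]
    refine ⟨fun h => ⟨(q - z2).toNat, ?_⟩, ?_⟩
    · push Not at h; omega
    · rintro ⟨k, h⟩; push Not; omega)
  unfold PrudentStep Adjacent
  simp only [← k1, ← k2, ← k3, ← k4, Prod.mk_sub_mk, Prod.mk.injEq]
  constructor
  · rintro ⟨h | h | h | h, hr⟩ <;> rw [h.1, h.2] at hr
    · exact Or.inl ⟨by omega, hr⟩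
    · exact Or.inr (Or.inl ⟨by omega, hr⟩)
    · exact Or.inr (Or.inr (Or.inl ⟨by omega, hr⟩))
    · exact Or.inr (Or.inr (Or.inr ⟨by omega, hr⟩))
  · rintro (⟨h, hr⟩ | ⟨h, hr⟩ | ⟨h, hr⟩ | ⟨h, hr⟩)
    · have h' : p' - p = 1 ∧ q' - q = 0 := by omega
      rw [h'.1, h'.2]
      exact ⟨by simp, hr⟩
    · have h' : p' - p = -1 ∧ q' - q = 0 := by omega
      rw [h'.1, h'.2]
      exact ⟨by simp, hr⟩
    · have h' : p' - p = 0 ∧ q' - q = 1 := by omega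
      rw [h'.1, h'.2]
      exact ⟨by simp, hr⟩
    · have h' : p' - p = 0 ∧ q' - q = -1 := by omega
      rw [h'.1, h'.2]
      exact ⟨by simp, hr⟩

theorem isPrudentWalk_concat {a : List Vertex} {e v : Vertex} :
    IsPrudentWalk (a ++ [e] ++ [v]) ↔ IsPrudentWalk (a ++ [e]) ∧ PrudentStep (a ++ [e]) e v := by
  rw [isPrudentWalk_concat_iff, adjacent_and_ray_iff]

theorem isPrudentWalk_singleton : IsPrudentWalk [(0, 0)] :=
  ⟨rfl, by simp, by simp, fun i h => by simp at h⟩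

theorem IsPrudentWalk.origin_mem {l : List Vertex} (h : IsPrudentWalk l) : (0, 0) ∈ l :=
  List.mem_of_mem_head? h.start

/-- A chain visits all intermediate levels between two of its vertices. -/
theorem exists_mem_eq_of_isChain {f : Vertex → ℤ}
    (hf : ∀ p q, Adjacent p q → |f q - f p| ≤ 1) {l : List Vertex} (hl : l.IsChain Adjacent)
    {v z : Vertex} (hv : v ∈ l) (hz : z ∈ l) {j : ℤ} (h1 : f v ≤ j) (h2 : j ≤ f z) :
    ∃ y ∈ l, f y = j := by
  have key : ∀ (l : List Vertex) (b : Vertex), (b :: l).IsChain Adjacent → ∀ v ∈ b :: l,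
      (f b ≤ j ∧ j ≤ f v ∨ f v ≤ j ∧ j ≤ f b) → ∃ y ∈ b :: l, f y = j := by
    intro l
    induction l with
    | nil =>
      intro b _ v hv h
      simp at hv
      subst hv
      exact ⟨v, by simp, by omega⟩
    | cons b' l ih =>
      intro b hc v hv h
      rw [List.isChain_cons_cons] at hc
      by_cases hb : f b = j
      · exact ⟨b, by simp, hb⟩
      rcases List.mem_cons.1 hv with rfl | hv
      · exact ⟨v, by simp, by omega⟩
      have := hf _ _ hc.1
      rw [abs_le] at this
      obtain ⟨y, hy, hyj⟩ := ih b' hc.2 v hv (by omega)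
      exact ⟨y, List.mem_cons_of_mem _ hy, hyj⟩
  cases l with
  | nil => simp at hv
  | cons b l =>
    rcases le_total (f b) j with h | h
    · exact key l b hl z hz (Or.inl ⟨h, h2⟩)
    · exact key l b hl v hv (Or.inr ⟨h1, h⟩)

theorem Adjacent.abs_fst {p q : Vertex} (h : Adjacent p q) : |q.1 - p.1| ≤ 1 := by
  rw [abs_le]
  obtain ⟨p1, p2⟩ := p
  obtain ⟨q1, q2⟩ := q
  simp only [Adjacent, Prod.mk_sub_mk, Prod.mk.injEq] at h ⊢
  omega

theorem Adjacent.abs_snd {p q : Vertex} (h : Adjacent p q) : |q.2 - p.2| ≤ 1 := by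
  rw [abs_le]
  obtain ⟨p1, p2⟩ := p
  obtain ⟨q1, q2⟩ := q
  simp only [Adjacent, Prod.mk_sub_mk, Prod.mk.injEq] at h ⊢
  omega

theorem exists_mem_fst_eq {l : List Vertex} (hl : l.IsChain Adjacent) {v z : Vertex}
    (hv : v ∈ l) (hz : z ∈ l) {j : ℤ} (h1 : v.1 ≤ j) (h2 : j ≤ z.1) : ∃ y ∈ l, y.1 = j :=
  exists_mem_eq_of_isChain (fun _ _ h => h.abs_fst) hl hv hz h1 h2

theorem exists_mem_snd_eq {l : List Vertex} (hl : l.IsChain Adjacent) {v z : Vertex}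
    (hv : v ∈ l) (hz : z ∈ l) {j : ℤ} (h1 : v.2 ≤ j) (h2 : j ≤ z.2) : ∃ y ∈ l, y.2 = j :=
  exists_mem_eq_of_isChain (fun _ _ h => h.abs_snd) hl hv hz h1 h2

/-- A step in the direction of increasing `X` does not lead into the interior of the box. -/
theorem not_interior_of_step {X Y : Vertex → ℤ} (hY : ∀ p q, Adjacent p q → |Y q - Y p| ≤ 1)
    (hXY : ∀ p q : Vertex, X p = X q → Y p = Y q → p = q) {a : List Vertex} {f e : Vertex}
    (ha : a.IsChain Adjacent) (hf : f ∉ a) (hray : ∀ z ∈ a ++ [f], Y z = Y f → X z ≤ X f)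
    (hXe : X e = X f + 1) (hYe : Y e = Y f)
    (ih : (∃ v ∈ a ++ [f], X v < X f) → (∃ v ∈ a ++ [f], X f < X v) →
      (∃ v ∈ a ++ [f], Y v < Y f) → (∃ v ∈ a ++ [f], Y f < Y v) → False)
    (h2 : ∃ v ∈ a ++ [f] ++ [e], X e < X v)
    (h3 : ∃ v ∈ a ++ [f] ++ [e], Y v < Y e) (h4 : ∃ v ∈ a ++ [f] ++ [e], Y e < Y v) : False := by
  obtain ⟨v2, m2, h2⟩ := h2
  obtain ⟨v3, m3, h3⟩ := h3
  obtain ⟨v4, m4, h4⟩ := h4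
  have m2 : v2 ∈ a ++ [f] := by
    rcases List.mem_append.1 m2 with m | m
    · exact m
    · simp at m; subst m; omega
  have m3 : v3 ∈ a := by
    simp at m3
    rcases m3 with m | rfl | rfl
    · exact m
    · omega
    · omega
  have m4 : v4 ∈ a := by
    simp at m4
    rcases m4 with m | rfl | rfl
    · exact m
    · omega
    · omega
  -- If `f` is not `X`-minimal, it was interior itself. Otherwise the earlier walk crosses the line
  -- `Y = Y f` at a point that is neither before `f` by minimality nor beyond it by prudence, so it
  -- has already visited `f`.
  by_cases hl : ∃ v ∈ a ++ [f], X v < X f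
  · exact ih hl ⟨v2, m2, by omega⟩ ⟨v3, by simp [m3], by omega⟩ ⟨v4, by simp [m4], by omega⟩
  · push Not at hl
    obtain ⟨z, hz, hzY⟩ := exists_mem_eq_of_isChain hY ha m3 m4 (j := Y f) (by omega) (by omega)
    have hz' : z ∈ a ++ [f] := by simp [hz]
    have := hl z hz'
    have := hray z hz' hzY
    exact hf (hXY z f (by omega) hzY ▸ hz)

/-- A prudent walk ends on the boundary of its box. -/
theorem IsPrudentWalk.not_interior {a : List Vertex} {e : Vertex} (h : IsPrudentWalk (a ++ [e]))
    (h1 : ∃ v ∈ a ++ [e], v.1 < e.1) (h2 : ∃ v ∈ a ++ [e], e.1 < v.1)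
    (h3 : ∃ v ∈ a ++ [e], v.2 < e.2) (h4 : ∃ v ∈ a ++ [e], e.2 < v.2) : False := by
  induction a using List.reverseRecOn generalizing e with
  | nil => simp at h1
  | append_singleton a f ih =>
    obtain ⟨hw, hs⟩ := isPrudentWalk_concat.1 h
    have ha : a.IsChain Adjacent := hw.chain.left_of_append
    have hf : f ∉ a := fun hfa =>
      (List.nodup_append.1 hw.selfAvoiding).2.2 f hfa f (by simp) rfl
    have ih := ih hw
    rcases hs with ⟨he, hr⟩ | ⟨he, hr⟩ | ⟨he, hr⟩ | ⟨he, hr⟩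
    · exact not_interior_of_step (X := Prod.fst) (Y := Prod.snd) (fun _ _ h => h.abs_snd)
        (fun _ _ => Prod.ext) ha hf hr (by rw [he]) (by rw [he]) ih h2 h3 h4
    · exact not_interior_of_step (X := fun v => -v.1) (Y := Prod.snd) (fun _ _ h => h.abs_snd)
        (fun _ _ h => Prod.ext (by simpa using h)) ha hf (fun z hz h => neg_le_neg (hr z hz h))
        (by rw [he]; dsimp only; ring) (by rw [he])
        (fun ⟨z, hz, k1⟩ ⟨z', hz', k2⟩ => ih ⟨z', hz', neg_lt_neg_iff.1 k2⟩
          ⟨z, hz, neg_lt_neg_iff.1 k1⟩)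
        (h1.imp fun z hz => ⟨hz.1, neg_lt_neg hz.2⟩) h3 h4
    · exact not_interior_of_step (X := Prod.snd) (Y := Prod.fst) (fun _ _ h => h.abs_fst)
        (fun _ _ h h' => Prod.ext h' h) ha hf hr (by rw [he]) (by rw [he])
        (fun k1 k2 k3 k4 => ih k3 k4 k1 k2) h4 h1 h2
    · exact not_interior_of_step (X := fun v => -v.2) (Y := Prod.fst) (fun _ _ h => h.abs_fst)
        (fun _ _ h h' => Prod.ext h' (by simpa using h)) ha hf
        (fun z hz h => neg_le_neg (hr z hz h)) (by rw [he]; dsimp only; ring) (by rw [he])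
        (fun ⟨z, hz, k1⟩ ⟨z', hz', k2⟩ k3 k4 => ih k3 k4 ⟨z', hz', neg_lt_neg_iff.1 k2⟩
          ⟨z, hz, neg_lt_neg_iff.1 k1⟩)
        (h3.imp fun z hz => ⟨hz.1, neg_lt_neg hz.2⟩) h1 h2

/-! ### Straight segments -/

/-- The vertices on the row of ordinate `y` after abscissa `c`, until abscissa `d`. -/
def hseg (y c d : ℤ) : List Vertex :=
  if c ≤ d then (List.range (d - c).toNat).map fun i : ℕ => (c + i + 1, y)
  else (List.range (c - d).toNat).map fun i : ℕ => (c - i - 1, y)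

/-- The vertices on the column of abscissa `x` after ordinate `c`, until ordinate `d`. -/
def vseg (x c d : ℤ) : List Vertex := (hseg x c d).map Prod.swap

theorem mem_hseg {y c d : ℤ} {v : Vertex} :
    v ∈ hseg y c d ↔ v.2 = y ∧ (c < v.1 ∧ v.1 ≤ d ∨ d ≤ v.1 ∧ v.1 < c) := by
  obtain ⟨v1, v2⟩ := v
  unfold hseg
  split_ifs
  · simp only [List.mem_map, List.mem_range, Prod.mk.injEq]
    refine ⟨?_, fun h => ⟨(v1 - c - 1).toNat, ?_⟩⟩
    · rintro ⟨i, h⟩; omega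
    · omega
  · simp only [List.mem_map, List.mem_range, Prod.mk.injEq]
    refine ⟨?_, fun h => ⟨(c - v1 - 1).toNat, ?_⟩⟩
    · rintro ⟨i, h⟩; omega
    · omega

theorem mem_map_swap {l : List Vertex} {v : Vertex} : v ∈ l.map Prod.swap ↔ v.swap ∈ l := by
  rw [List.mem_map]
  exact ⟨fun ⟨z, hz, h⟩ => by rwa [← h, Prod.swap_swap], fun h => ⟨_, h, v.swap_swap⟩⟩

theorem mem_vseg {x c d : ℤ} {v : Vertex} :
    v ∈ vseg x c d ↔ v.1 = x ∧ (c < v.2 ∧ v.2 ≤ d ∨ d ≤ v.2 ∧ v.2 < c) := by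
  rw [vseg, mem_map_swap]
  exact mem_hseg

@[simp] theorem length_hseg (y c d : ℤ) : (hseg y c d).length = (d - c).natAbs := by
  unfold hseg
  split_ifs <;> simp <;> omega

@[simp] theorem length_vseg (x c d : ℤ) : (vseg x c d).length = (d - c).natAbs := by
  simp [vseg]

@[simp] theorem hseg_self (y c : ℤ) : hseg y c c = [] := by simp [hseg]

@[simp] theorem vseg_self (x c : ℤ) : vseg x c c = [] := by simp [vseg]

theorem hseg_add_one {y c d : ℤ} (h : c ≤ d) : hseg y c (d + 1) = hseg y c d ++ [(d + 1, y)] := by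
  rw [hseg, hseg, if_pos (by omega), if_pos h, show (d + 1 - c).toNat = (d - c).toNat + 1 by omega,
    List.range_succ, List.map_append]
  simp
  omega

theorem hseg_sub_one {y c d : ℤ} (h : d ≤ c) : hseg y c (d - 1) = hseg y c d ++ [(d - 1, y)] := by
  rw [hseg, if_neg (by omega), show (c - (d - 1)).toNat = (c - d).toNat + 1 by omega,
    List.range_succ, List.map_append]
  rcases h.eq_or_lt with rfl | h
  · simp
  · rw [hseg, if_neg (by omega)]
    simp
    omega

theorem vseg_add_one {x c d : ℤ} (h : c ≤ d) : vseg x c (d + 1) = vseg x c d ++ [(x, d + 1)] := by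
  simp [vseg, hseg_add_one h]

theorem vseg_sub_one {x c d : ℤ} (h : d ≤ c) : vseg x c (d - 1) = vseg x c d ++ [(x, d - 1)] := by
  simp [vseg, hseg_sub_one h]

/-- Splits off the last vertex of a segment that may be empty or point in either direction, so that
`isPrudentWalk_concat` applies to walks ending in such a segment. -/
theorem exists_cons_hseg (y c d : ℤ) : ∃ b, (c, y) :: hseg y c d = b ++ [(d, y)] ∧
    ∀ v ∈ b, v.2 = y ∧ (c ≤ v.1 ∧ v.1 < d ∨ d < v.1 ∧ v.1 ≤ c) := by
  rcases lt_trichotomy c d with h | rfl | h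
  · refine ⟨(c, y) :: hseg y c (d - 1), ?_, ?_⟩
    · have := hseg_add_one (y := y) (c := c) (d := d - 1) (by omega)
      rw [sub_add_cancel] at this
      rw [this]; rfl
    · rintro v hv
      rcases List.mem_cons.1 hv with rfl | hv
      · simp; omega
      · rw [mem_hseg] at hv; omega
  · exact ⟨[], by simp, by simp⟩
  · refine ⟨(c, y) :: hseg y c (d + 1), ?_, ?_⟩
    · have := hseg_sub_one (y := y) (c := c) (d := d + 1) (by omega)
      rw [add_sub_cancel_right] at this
      rw [this]; rfl
    · rintro v hv
      rcases List.mem_cons.1 hv with rfl | hv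
      · simp; omega
      · rw [mem_hseg] at hv; omega

theorem exists_cons_vseg (x c d : ℤ) : ∃ b, (x, c) :: vseg x c d = b ++ [(x, d)] ∧
    ∀ v ∈ b, v.1 = x ∧ (c ≤ v.2 ∧ v.2 < d ∨ d < v.2 ∧ v.2 ≤ c) := by
  obtain ⟨b, hb, hb'⟩ := exists_cons_hseg x c d
  refine ⟨b.map Prod.swap, ?_, fun v hv => hb' v.swap (mem_map_swap.1 hv)⟩
  have := congr_arg (List.map Prod.swap) hb
  simpa [vseg] using this

/-- A walk may be prolonged within a row in which it has visited its last vertex only. -/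
theorem IsPrudentWalk.append_hseg {a : List Vertex} {c y : ℤ}
    (h : IsPrudentWalk (a ++ [(c, y)])) (hy : ∀ v ∈ a, v.2 ≠ y) (d : ℤ) :
    IsPrudentWalk (a ++ [(c, y)] ++ hseg y c d) := by
  have key : ∀ d d' : ℤ, (c ≤ d ∧ d' = d + 1 ∨ d ≤ c ∧ d' = d - 1) →
      IsPrudentWalk (a ++ [(c, y)] ++ hseg y c d) →
      IsPrudentWalk (a ++ [(c, y)] ++ hseg y c d') := by
    intro d d' hd hw
    obtain ⟨b, hb, hb'⟩ := exists_cons_hseg y c d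
    have hd' : hseg y c d' = hseg y c d ++ [(d', y)] := by
      rcases hd with ⟨hd, rfl⟩ | ⟨hd, rfl⟩
      · exact hseg_add_one hd
      · exact hseg_sub_one hd
    have hl : a ++ [(c, y)] ++ hseg y c d = a ++ b ++ [(d, y)] := by
      rw [List.append_assoc, List.append_assoc, ← hb]; rfl
    rw [hd', ← List.append_assoc, hl, isPrudentWalk_concat, ← hl]
    refine ⟨hw, ?_⟩
    rw [hl]
    have hz : ∀ z ∈ a ++ b ++ [(d, y)], z.2 = y → (c ≤ z.1 ∧ z.1 ≤ d ∨ d ≤ z.1 ∧ z.1 ≤ c) := by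
      intro z hz hzy
      simp only [List.mem_append, List.mem_singleton] at hz
      rcases hz with (hz | hz) | rfl
      · exact absurd hzy (hy z hz)
      · have := hb' z hz
        omega
      · simp; omega
    rcases hd with ⟨hd, rfl⟩ | ⟨hd, rfl⟩
    · exact Or.inl ⟨rfl, fun z h1 h2 => by have := hz z h1 h2; simp only; omega⟩
    · exact Or.inr (Or.inl ⟨rfl, fun z h1 h2 => by have := hz z h1 h2; simp only; omega⟩)
  rcases le_total c d with hd | hd
  · induction d, hd using Int.leInduction with
    | base => simpa using h
    | succ d hd ih => exact key d _ (Or.inl ⟨hd, rfl⟩) ih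
  · induction d, hd using Int.leInductionDown with
    | base => simpa using h
    | pred d hd ih => exact key d _ (Or.inr ⟨hd, rfl⟩) ih

/-- A walk may be prolonged within a column in which it has visited its last vertex only. -/
theorem IsPrudentWalk.append_vseg {a : List Vertex} {c x : ℤ}
    (h : IsPrudentWalk (a ++ [(x, c)])) (hx : ∀ v ∈ a, v.1 ≠ x) (d : ℤ) :
    IsPrudentWalk (a ++ [(x, c)] ++ vseg x c d) := by
  have key : ∀ d d' : ℤ, (c ≤ d ∧ d' = d + 1 ∨ d ≤ c ∧ d' = d - 1) →
      IsPrudentWalk (a ++ [(x, c)] ++ vseg x c d) →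
      IsPrudentWalk (a ++ [(x, c)] ++ vseg x c d') := by
    intro d d' hd hw
    obtain ⟨b, hb, hb'⟩ := exists_cons_vseg x c d
    have hd' : vseg x c d' = vseg x c d ++ [(x, d')] := by
      rcases hd with ⟨hd, rfl⟩ | ⟨hd, rfl⟩
      · exact vseg_add_one hd
      · exact vseg_sub_one hd
    have hl : a ++ [(x, c)] ++ vseg x c d = a ++ b ++ [(x, d)] := by
      rw [List.append_assoc, List.append_assoc, ← hb]; rfl
    rw [hd', ← List.append_assoc, hl, isPrudentWalk_concat, ← hl]
    refine ⟨hw, ?_⟩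
    rw [hl]
    have hz : ∀ z ∈ a ++ b ++ [(x, d)], z.1 = x → (c ≤ z.2 ∧ z.2 ≤ d ∨ d ≤ z.2 ∧ z.2 ≤ c) := by
      intro z hz hzx
      simp only [List.mem_append, List.mem_singleton] at hz
      rcases hz with (hz | hz) | rfl
      · exact absurd hzx (hx z hz)
      · have := hb' z hz
        omega
      · simp; omega
    rcases hd with ⟨hd, rfl⟩ | ⟨hd, rfl⟩
    · exact Or.inr (Or.inr (Or.inl ⟨rfl, fun z h1 h2 => by have := hz z h1 h2; simp only; omega⟩))
    · exact Or.inr (Or.inr (Or.inr ⟨rfl, fun z h1 h2 => by have := hz z h1 h2; simp only; omega⟩))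
  rcases le_total c d with hd | hd
  · induction d, hd using Int.leInduction with
    | base => simpa using h
    | succ d hd ih => exact key d _ (Or.inl ⟨hd, rfl⟩) ih
  · induction d, hd using Int.leInductionDown with
    | base => simpa using h
    | pred d hd ih => exact key d _ (Or.inr ⟨hd, rfl⟩) ih

/-! ### Record walks and their invariants -/

/-- Sides of the box on which a walk in the left half plane attains new extreme coordinates. -/
inductive Side
  | top
  | left
  | bottom

/-- Walks in the left half plane which end where they first reach a side of their box.
`RecordWalk σ p c L B T` says that `p` has just reached the side `σ` and that `c` is the other
coordinate of its last vertex, while `L`, `B`, `T` are the left, bottom and top sides of the box of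
the polygon in which `p` is completed by following the box clockwise. -/
inductive RecordWalk : Side → List Vertex → ℤ → ℤ → ℤ → ℤ → Prop
  | origin : RecordWalk .left [(0, 0)] 0 0 0 1
  | top_top {p : List Vertex} {c L B T : ℤ} (d : ℤ) : RecordWalk .top p c L B T → L ≤ d → d ≤ 0 →
      RecordWalk .top (p ++ hseg T c d ++ [(d, T + 1)]) d L B (T + 1)
  | top_left {p : List Vertex} {c L B T : ℤ} : RecordWalk .top p c L B T →
      RecordWalk .left (p ++ hseg T c (L - 1)) T (L - 1) B (T + 1)
  | left_top {p : List Vertex} {c L B T : ℤ} : RecordWalk .left p c L B T →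
      RecordWalk .top (p ++ vseg L c T) L L B T
  | left_left {p : List Vertex} {c L B T : ℤ} (d : ℤ) : RecordWalk .left p c L B T → B ≤ d → d < T →
      RecordWalk .left (p ++ vseg L c d ++ [(L - 1, d)]) d (L - 1) B T
  | left_bottom {p : List Vertex} {c L B T : ℤ} : RecordWalk .left p c L B T →
      RecordWalk .bottom (p ++ vseg L c (B - 1)) L (L - 1) (B - 1) T
  | bottom_bottom {p : List Vertex} {c L B T : ℤ} (d : ℤ) : RecordWalk .bottom p c L B T → L < d →
      d ≤ 0 → RecordWalk .bottom (p ++ hseg B c d ++ [(d, B - 1)]) d L (B - 1) T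
  | bottom_left {p : List Vertex} {c L B T : ℤ} : RecordWalk .bottom p c L B T →
      RecordWalk .left (p ++ hseg B c L) B L B T

/-- Properties of the walks which have just reached the top side. -/
structure TopInv (p : List Vertex) (c L B T : ℤ) : Prop where
  walk : IsPrudentWalk p
  last : ∃ a, p = a ++ [(c, T)] ∧ ∀ v ∈ a, v.2 < T
  box : ∀ v ∈ p, L ≤ v.1 ∧ v.1 ≤ 0 ∧ B ≤ v.2 ∧ v.2 ≤ T
  left_mem : ∃ v ∈ p, v.1 = L ∧ v.2 < T
  bottom_mem : ∃ v ∈ p, v.2 = B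
  pos : 1 ≤ T
  parity : ((p.length : ℤ) + 1 + c + T) % 2 = 0

/-- Properties of the walks which have just reached the left side. -/
structure LeftInv (p : List Vertex) (c L B T : ℤ) : Prop where
  walk : IsPrudentWalk p
  last : ∃ a, p = a ++ [(L, c)] ∧ ∀ v ∈ a, L < v.1
  box : ∀ v ∈ p, L ≤ v.1 ∧ v.1 ≤ 0 ∧ B ≤ v.2 ∧ v.2 < T
  top_mem : ∃ v ∈ p, v.2 = T - 1
  bottom_mem : ∃ v ∈ p, v.2 = B
  parity : ((p.length : ℤ) + 1 + c + L) % 2 = 0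

/-- Properties of the walks which have just reached the bottom side. -/
structure BottomInv (p : List Vertex) (c L B T : ℤ) : Prop where
  walk : IsPrudentWalk p
  last : ∃ a, p = a ++ [(c, B)] ∧ ∀ v ∈ a, B < v.2
  box : ∀ v ∈ p, L < v.1 ∧ v.1 ≤ 0 ∧ B ≤ v.2 ∧ v.2 < T
  top_mem : ∃ v ∈ p, v.2 = T - 1
  left_mem : ∃ v ∈ p, v.1 = L + 1 ∧ B < v.2
  neg : B < 0
  parity : ((p.length : ℤ) + 1 + c + B) % 2 = 0

theorem append_cons_hseg (a : List Vertex) (y c d : ℤ) :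
    ∃ b, a ++ [(c, y)] ++ hseg y c d = a ++ b ++ [(d, y)] ∧
      ∀ v ∈ b, v.2 = y ∧ (c ≤ v.1 ∧ v.1 < d ∨ d < v.1 ∧ v.1 ≤ c) := by
  obtain ⟨b, hb, hb'⟩ := exists_cons_hseg y c d
  exact ⟨b, by rw [List.append_assoc, List.append_assoc, ← hb]; rfl, hb'⟩

theorem append_cons_vseg (a : List Vertex) (x c d : ℤ) :
    ∃ b, a ++ [(x, c)] ++ vseg x c d = a ++ b ++ [(x, d)] ∧
      ∀ v ∈ b, v.1 = x ∧ (c ≤ v.2 ∧ v.2 < d ∨ d < v.2 ∧ v.2 ≤ c) := by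
  obtain ⟨b, hb, hb'⟩ := exists_cons_vseg x c d
  exact ⟨b, by rw [List.append_assoc, List.append_assoc, ← hb]; rfl, hb'⟩

theorem TopInv.top_top {p : List Vertex} {c L B T : ℤ} (h : TopInv p c L B T) {d : ℤ}
    (hL : L ≤ d) (hd : d ≤ 0) :
    TopInv (p ++ hseg T c d ++ [(d, T + 1)]) d L B (T + 1) := by
  obtain ⟨hw, ⟨a, rfl, ha⟩, hbox, ⟨l, hl, hl1, hl2⟩, ⟨b, hb, hb'⟩, hpos, hpar⟩ := h
  have hc := hbox (c, T) (by simp)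
  have hw' := hw.append_hseg (fun v hv => (ha v hv).ne) d
  have hbox' : ∀ v ∈ a ++ [(c, T)] ++ hseg T c d, L ≤ v.1 ∧ v.1 ≤ 0 ∧ B ≤ v.2 ∧ v.2 ≤ T := by
    intro v hv
    rcases List.mem_append.1 hv with hv | hv
    · exact hbox v hv
    · rw [mem_hseg] at hv
      omega
  refine ⟨?_, ⟨_, rfl, fun v hv => by have := hbox' v hv; omega⟩, ?_,
    ⟨l, List.mem_append_left _ (List.mem_append_left _ hl), hl1, by omega⟩,
    ⟨b, List.mem_append_left _ (List.mem_append_left _ hb), hb'⟩,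
    by omega, ?_⟩
  · obtain ⟨b, hb, _⟩ := append_cons_hseg a T c d
    rw [hb] at hw' hbox' ⊢
    rw [isPrudentWalk_concat]
    exact ⟨hw', Or.inr (Or.inr (Or.inl ⟨rfl, fun v hv _ => (hbox' v hv).2.2.2⟩))⟩
  · intro v hv
    rcases List.mem_append.1 hv with hv | hv
    · have := hbox' v hv
      omega
    · simp at hv
      subst hv
      simp only
      omega
  · simp only [List.length_append, length_hseg, List.length_cons, List.length_nil] at hpar ⊢
    omega

theorem TopInv.top_left {p : List Vertex} {c L B T : ℤ} (h : TopInv p c L B T) :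
    LeftInv (p ++ hseg T c (L - 1)) T (L - 1) B (T + 1) := by
  obtain ⟨hw, ⟨a, rfl, ha⟩, hbox, -, ⟨b, hb, hb'⟩, hpos, hpar⟩ := h
  have hc := hbox (c, T) (by simp)
  have hw' := hw.append_hseg (fun v hv => (ha v hv).ne) (L - 1)
  refine ⟨hw', ?_, ?_, ⟨(c, T), by simp, by simp⟩, ⟨b, List.mem_append_left _ hb, hb'⟩, ?_⟩
  · obtain ⟨b, hb, hb'⟩ := append_cons_hseg a T c (L - 1)
    refine ⟨_, hb, fun v hv => ?_⟩
    rcases List.mem_append.1 hv with hv | hv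
    · have := hbox v (by simp [hv])
      omega
    · have := hb' v hv
      omega
  · intro v hv
    rcases List.mem_append.1 hv with hv | hv
    · have := hbox v hv
      omega
    · rw [mem_hseg] at hv
      omega
  · simp only [List.length_append, length_hseg, List.length_cons, List.length_nil] at hpar ⊢
    omega

theorem LeftInv.pos {p : List Vertex} {c L B T : ℤ} (h : LeftInv p c L B T) : 1 ≤ T := by
  have := h.box _ h.walk.origin_mem
  omega

theorem LeftInv.left_top {p : List Vertex} {c L B T : ℤ} (h : LeftInv p c L B T) :
    TopInv (p ++ vseg L c T) L L B T := by
  have hpos := h.pos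
  obtain ⟨hw, ⟨a, rfl, ha⟩, hbox, -, ⟨b, hb, hb'⟩, hpar⟩ := h
  have hc := hbox (L, c) (by simp)
  have hw' := hw.append_vseg (fun v hv => (ha v hv).ne') T
  refine ⟨hw', ?_, ?_, ⟨(L, c), by simp, rfl, hc.2.2.2⟩, ⟨b, List.mem_append_left _ hb, hb'⟩,
    hpos, ?_⟩
  · obtain ⟨b, hb, hb'⟩ := append_cons_vseg a L c T
    refine ⟨_, hb, fun v hv => ?_⟩
    rcases List.mem_append.1 hv with hv | hv
    · have := hbox v (by simp [hv])
      omega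
    · have := hb' v hv
      omega
  · intro v hv
    rcases List.mem_append.1 hv with hv | hv
    · have := hbox v hv
      omega
    · rw [mem_vseg] at hv
      omega
  · simp only [List.length_append, length_vseg, List.length_cons, List.length_nil] at hpar ⊢
    omega

theorem LeftInv.left_left {p : List Vertex} {c L B T : ℤ} (h : LeftInv p c L B T) {d : ℤ}
    (hB : B ≤ d) (hd : d < T) :
    LeftInv (p ++ vseg L c d ++ [(L - 1, d)]) d (L - 1) B T := by
  obtain ⟨hw, ⟨a, rfl, ha⟩, hbox, ⟨l, hl, hl'⟩, ⟨b, hb, hb'⟩, hpar⟩ := h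
  have hc := hbox (L, c) (by simp)
  have hw' := hw.append_vseg (fun v hv => (ha v hv).ne') d
  have hbox' : ∀ v ∈ a ++ [(L, c)] ++ vseg L c d, L ≤ v.1 ∧ v.1 ≤ 0 ∧ B ≤ v.2 ∧ v.2 < T := by
    intro v hv
    rcases List.mem_append.1 hv with hv | hv
    · exact hbox v hv
    · rw [mem_vseg] at hv
      omega
  refine ⟨?_, ⟨_, rfl, fun v hv => by have := hbox' v hv; omega⟩, ?_,
    ⟨l, List.mem_append_left _ (List.mem_append_left _ hl), hl'⟩,
    ⟨b, List.mem_append_left _ (List.mem_append_left _ hb), hb'⟩,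
    ?_⟩
  · obtain ⟨b, hb, _⟩ := append_cons_vseg a L c d
    rw [hb] at hw' hbox' ⊢
    rw [isPrudentWalk_concat]
    exact ⟨hw', Or.inr (Or.inl ⟨rfl, fun v hv _ => (hbox' v hv).1⟩)⟩
  · intro v hv
    rcases List.mem_append.1 hv with hv | hv
    · have := hbox' v hv
      omega
    · simp at hv
      subst hv
      simp only
      omega
  · simp only [List.length_append, length_vseg, List.length_cons, List.length_nil] at hpar ⊢
    omega

theorem LeftInv.left_bottom {p : List Vertex} {c L B T : ℤ} (h : LeftInv p c L B T) :
    BottomInv (p ++ vseg L c (B - 1)) L (L - 1) (B - 1) T := by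
  have hpos := h.pos
  obtain ⟨hw, ⟨a, rfl, ha⟩, hbox, ⟨l, hl, hl'⟩, -, hpar⟩ := h
  have hc := hbox (L, c) (by simp)
  have hw' := hw.append_vseg (fun v hv => (ha v hv).ne') (B - 1)
  have h0 := hbox _ hw.origin_mem
  refine ⟨hw', ?_, ?_, ⟨l, List.mem_append_left _ hl, hl'⟩, ⟨(L, c), by simp, by simp, ?_⟩,
    by omega, ?_⟩
  · obtain ⟨b, hb, hb'⟩ := append_cons_vseg a L c (B - 1)
    refine ⟨_, hb, fun v hv => ?_⟩
    rcases List.mem_append.1 hv with hv | hv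
    · have := hbox v (by simp [hv])
      omega
    · have := hb' v hv
      omega
  · intro v hv
    rcases List.mem_append.1 hv with hv | hv
    · have := hbox v hv
      omega
    · rw [mem_vseg] at hv
      omega
  · simp only
    omega
  · simp only [List.length_append, length_vseg, List.length_cons, List.length_nil] at hpar ⊢
    omega

theorem BottomInv.bottom_bottom {p : List Vertex} {c L B T : ℤ} (h : BottomInv p c L B T) {d : ℤ}
    (hL : L < d) (hd : d ≤ 0) :
    BottomInv (p ++ hseg B c d ++ [(d, B - 1)]) d L (B - 1) T := by
  obtain ⟨hw, ⟨a, rfl, ha⟩, hbox, ⟨b, hb, hb'⟩, ⟨l, hl, hl1, hl2⟩, hneg, hpar⟩ := h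
  have hc := hbox (c, B) (by simp)
  have hw' := hw.append_hseg (fun v hv => (ha v hv).ne') d
  have hbox' : ∀ v ∈ a ++ [(c, B)] ++ hseg B c d, L < v.1 ∧ v.1 ≤ 0 ∧ B ≤ v.2 ∧ v.2 < T := by
    intro v hv
    rcases List.mem_append.1 hv with hv | hv
    · exact hbox v hv
    · rw [mem_hseg] at hv
      omega
  refine ⟨?_, ⟨_, rfl, fun v hv => by have := hbox' v hv; omega⟩, ?_,
    ⟨b, List.mem_append_left _ (List.mem_append_left _ hb), hb'⟩,
    ⟨l, List.mem_append_left _ (List.mem_append_left _ hl), hl1, by omega⟩,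
    by omega, ?_⟩
  · obtain ⟨b, hb, _⟩ := append_cons_hseg a B c d
    rw [hb] at hw' hbox' ⊢
    rw [isPrudentWalk_concat]
    exact ⟨hw', Or.inr (Or.inr (Or.inr ⟨rfl, fun v hv _ => (hbox' v hv).2.2.1⟩))⟩
  · intro v hv
    rcases List.mem_append.1 hv with hv | hv
    · have := hbox' v hv
      omega
    · simp at hv
      subst hv
      simp only
      omega
  · simp only [List.length_append, length_hseg, List.length_cons, List.length_nil] at hpar ⊢
    omega

theorem BottomInv.bottom_left {p : List Vertex} {c L B T : ℤ} (h : BottomInv p c L B T) :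
    LeftInv (p ++ hseg B c L) B L B T := by
  obtain ⟨hw, ⟨a, rfl, ha⟩, hbox, ⟨l, hl, hl'⟩, -, -, hpar⟩ := h
  have hc := hbox (c, B) (by simp)
  have hw' := hw.append_hseg (fun v hv => (ha v hv).ne') L
  refine ⟨hw', ?_, ?_, ⟨l, List.mem_append_left _ hl, hl'⟩, ⟨(c, B), by simp, rfl⟩, ?_⟩
  · obtain ⟨b, hb, hb'⟩ := append_cons_hseg a B c L
    refine ⟨_, hb, fun v hv => ?_⟩
    rcases List.mem_append.1 hv with hv | hv
    · have := hbox v (by simp [hv])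
      omega
    · have := hb' v hv
      omega
  · intro v hv
    rcases List.mem_append.1 hv with hv | hv
    · have := hbox v hv
      omega
    · rw [mem_hseg] at hv
      omega
  · simp only [List.length_append, length_hseg, List.length_cons, List.length_nil] at hpar ⊢
    omega

/-- The properties of record walks, according to the side which has been reached. -/
def RecordInv : Side → List Vertex → ℤ → ℤ → ℤ → ℤ → Prop
  | .top => TopInv
  | .left => LeftInv
  | .bottom => BottomInv

theorem leftInv_origin : LeftInv [(0, 0)] 0 0 0 1 :=
  ⟨isPrudentWalk_singleton, ⟨[], by simp, by simp⟩, by simp, by simp, by simp, by simp⟩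

theorem RecordWalk.inv {σ : Side} {p : List Vertex} {c L B T : ℤ} (h : RecordWalk σ p c L B T) :
    RecordInv σ p c L B T := by
  induction h with
  | origin => exact leftInv_origin
  | top_top d _ hL hd ih => exact TopInv.top_top ih hL hd
  | top_left _ ih => exact TopInv.top_left ih
  | left_top _ ih => exact LeftInv.left_top ih
  | left_left d _ hB hd ih => exact LeftInv.left_left ih hB hd
  | left_bottom _ ih => exact LeftInv.left_bottom ih
  | bottom_bottom d _ hL hd ih => exact BottomInv.bottom_bottom ih hL hd
  | bottom_left _ ih => exact BottomInv.bottom_left ih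

theorem RecordWalk.topInv {p : List Vertex} {c L B T : ℤ} (h : RecordWalk .top p c L B T) :
    TopInv p c L B T := h.inv

theorem RecordWalk.leftInv {p : List Vertex} {c L B T : ℤ} (h : RecordWalk .left p c L B T) :
    LeftInv p c L B T := h.inv

theorem RecordWalk.bottomInv {p : List Vertex} {c L B T : ℤ} (h : RecordWalk .bottom p c L B T) :
    BottomInv p c L B T := h.inv

/-! ### Every polygon in `classF` comes from a record walk -/

/-- Record walks prolonged along the side they have reached, and their last vertices. -/
inductive Prolonged : List Vertex → Vertex → Prop
  | top {p : List Vertex} {c L B T : ℤ} (d : ℤ) : RecordWalk .top p c L B T → L ≤ d → d ≤ 0 →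
      Prolonged (p ++ hseg T c d) (d, T)
  | left {p : List Vertex} {c L B T : ℤ} (d : ℤ) : RecordWalk .left p c L B T → B ≤ d → d < T →
      Prolonged (p ++ vseg L c d) (L, d)
  | bottom {p : List Vertex} {c L B T : ℤ} (d : ℤ) : RecordWalk .bottom p c L B T → L < d → d ≤ 0 →
      Prolonged (p ++ hseg B c d) (d, B)

/-- Before reaching the top side, the walk has visited the column `L` and the origin, hence every
column between them. This forbids steps from the top side back into the box. -/
theorem TopInv.exists_below {p : List Vertex} {c L B T d : ℤ} (h : TopInv p c L B T)
    (hL : L ≤ d) (hd : d ≤ 0) : ∃ z ∈ p, z.1 = d ∧ z.2 < T := by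
  obtain ⟨hw, ⟨a, rfl, ha⟩, hbox, ⟨l, hl, hl1, hl2⟩, -, hpos, -⟩ := h
  have mem : ∀ v ∈ a ++ [(c, T)], v.2 < T → v ∈ a := by
    intro v hv hvT
    rcases List.mem_append.1 hv with hv | hv
    · exact hv
    · simp at hv; subst hv; simp at hvT
  obtain ⟨z, hz, hzd⟩ := exists_mem_fst_eq hw.chain.left_of_append (mem l hl hl2)
    (mem _ hw.origin_mem (by simp only; omega)) (j := d) (by omega) hd
  exact ⟨z, by simp [hz], hzd, ha z hz⟩

/-- The step onto a new left side is horizontal, so each row met by the walk was already met to the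
right of that side. The exception is the walk consisting of the origin only. -/
theorem LeftInv.exists_right {p : List Vertex} {c L B T d : ℤ} (h : LeftInv p c L B T)
    (hB : B ≤ d) (hd : d < T) : (L = 0 ∧ d = 0) ∨ ∃ z ∈ p, z.2 = d ∧ L < z.1 := by
  obtain ⟨hw, ⟨a, rfl, ha⟩, hbox, ⟨v, hv, hv'⟩, ⟨b, hb, hb'⟩, -⟩ := h
  rcases List.eq_nil_or_concat' a with rfl | ⟨a, f, rfl⟩
  · have h0 := hw.origin_mem
    simp at h0 hv hb
    subst hv hb
    simp only at hv' hb'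
    omega
  · right
    have hs := (isPrudentWalk_concat.1 hw).2
    have hf := ha f (by simp)
    have hfc : f.2 = c := by
      rcases hs with ⟨h, -⟩ | ⟨h, -⟩ | ⟨h, -⟩ | ⟨h, -⟩ <;> rw [Prod.mk.injEq] at h <;> omega
    have lift : ∀ v ∈ a ++ [f] ++ [(L, c)], ∃ z ∈ a ++ [f], z.2 = v.2 := by
      intro v hv
      rcases List.mem_append.1 hv with hv | hv
      · exact ⟨v, hv, rfl⟩
      · simp at hv; subst hv; exact ⟨f, by simp, hfc⟩
    obtain ⟨v, hv, hvT⟩ := lift v hv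
    obtain ⟨b, hb, hbB⟩ := lift b hb
    obtain ⟨z, hz, hzd⟩ := exists_mem_snd_eq hw.chain.left_of_append hb hv (j := d) (by omega)
      (by omega)
    exact ⟨z, List.mem_append_left _ hz, hzd, ha z hz⟩

theorem BottomInv.exists_above {p : List Vertex} {c L B T d : ℤ} (h : BottomInv p c L B T)
    (hL : L < d) (hd : d ≤ 0) : ∃ z ∈ p, z.1 = d ∧ B < z.2 := by
  obtain ⟨hw, ⟨a, rfl, ha⟩, hbox, -, ⟨l, hl, hl1, hl2⟩, hneg, -⟩ := h
  have mem : ∀ v ∈ a ++ [(c, B)], B < v.2 → v ∈ a := by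
    intro v hv hvT
    rcases List.mem_append.1 hv with hv | hv
    · exact hv
    · simp at hv; subst hv; simp at hvT
  obtain ⟨z, hz, hzd⟩ := exists_mem_fst_eq hw.chain.left_of_append (mem l hl hl2)
    (mem _ hw.origin_mem (by simpa using hneg)) (j := d) (by omega) hd
  exact ⟨z, by simp [hz], hzd, ha z hz⟩

theorem prudentStep_of_append {q a : List Vertex} {e v : Vertex} (hq : q = a ++ [e])
    (h : IsPrudentWalk (q ++ [v])) : PrudentStep q e v := by
  subst hq
  exact (isPrudentWalk_concat.1 h).2

/-- Prudence allows three continuations on a side: further along it in the same direction, possibly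
past a corner, or outwards. Steps inwards are blocked by the occupied vertices found above. The
other two alternatives are the ways to enter the line of abscissa `1`. -/
theorem Prolonged.step {q : List Vertex} {e v : Vertex} (h : Prolonged q e)
    (hv : IsPrudentWalk (q ++ [v])) :
    Prolonged (q ++ [v]) v ∨
    (∃ p c L B T, RecordWalk .top p c L B T ∧ q = p ++ hseg T c 0 ∧ v = (1, T)) ∨
    (v.1 = 1 ∧ v.2 ≤ 0) := by
  cases h with
  | @top p c L B T d hr hL hd =>
    have inv := hr.topInv
    obtain ⟨a, hp, -⟩ := inv.last
    have hcp : (c, T) ∈ p := by rw [hp]; simp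
    have hc := inv.box _ hcp
    obtain ⟨b, hb, -⟩ := append_cons_hseg a T c d
    rw [← hp] at hb
    rcases prudentStep_of_append hb hv with ⟨rfl, hs⟩ | ⟨rfl, hs⟩ | ⟨rfl, hs⟩ | ⟨rfl, hs⟩
    · have hcd : c ≤ d := hs (c, T) (List.mem_append_left _ hcp) rfl
      rcases hd.lt_or_eq with hd | rfl
      · left
        simp only
        rw [List.append_assoc, ← hseg_add_one hcd]
        exact .top _ hr (by omega) (by omega)
      · exact Or.inr (Or.inl ⟨p, c, L, B, T, hr, rfl, rfl⟩)
    · have hcd : d ≤ c := hs (c, T) (List.mem_append_left _ hcp) rfl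
      left
      simp only
      rw [List.append_assoc, ← hseg_sub_one hcd]
      rcases hL.lt_or_eq with hL | rfl
      · exact .top _ hr (by omega) (by omega)
      -- Passing the corner makes the new vertex a record on the left side, with an empty
      -- prolongation.
      · have := Prolonged.left T hr.top_left (by simpa using hc.2.2.1) (by omega)
        rwa [vseg_self, List.append_nil] at this
    · left
      have := Prolonged.top d (hr.top_top d hL hd) hL hd
      rwa [hseg_self, List.append_nil] at this
    · obtain ⟨z, hz, h1, h2⟩ := inv.exists_below hL hd
      have := hs z (List.mem_append_left _ hz) h1
      simp only at this
      omega
  | @left p c L B T d hr hB hd =>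
    have inv := hr.leftInv
    obtain ⟨a, hp, -⟩ := inv.last
    have hcp : (L, c) ∈ p := by rw [hp]; simp
    have hc := inv.box _ hcp
    obtain ⟨b, hb, -⟩ := append_cons_vseg a L c d
    rw [← hp] at hb
    rcases prudentStep_of_append hb hv with ⟨rfl, hs⟩ | ⟨rfl, hs⟩ | ⟨rfl, hs⟩ | ⟨rfl, hs⟩
    · rcases inv.exists_right hB hd with ⟨rfl, rfl⟩ | ⟨z, hz, h1, h2⟩
      · exact Or.inr (Or.inr ⟨rfl, le_rfl⟩)
      · have := hs z (List.mem_append_left _ hz) h1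
        simp only at this
        omega
    · left
      have := Prolonged.left d (hr.left_left d hB hd) hB hd
      rwa [vseg_self, List.append_nil] at this
    · have hcd : c ≤ d := hs (L, c) (List.mem_append_left _ hcp) rfl
      left
      simp only
      rw [List.append_assoc, ← vseg_add_one hcd]
      rcases (show d + 1 ≤ T by omega).lt_or_eq with hd | rfl
      · exact .left _ hr (by omega) hd
      · have := Prolonged.top L hr.left_top le_rfl (by simpa using hc.2.1)
        rwa [hseg_self, List.append_nil] at this
    · have hcd : d ≤ c := hs (L, c) (List.mem_append_left _ hcp) rfl
      left
      simp only
      rw [List.append_assoc, ← vseg_sub_one hcd]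
      rcases hB.lt_or_eq with hB | rfl
      · exact .left _ hr (by omega) (by omega)
      · have := Prolonged.bottom L hr.left_bottom (by omega) (by simpa using hc.2.1)
        rwa [hseg_self, List.append_nil] at this
  | @bottom p c L B T d hr hL hd =>
    have inv := hr.bottomInv
    obtain ⟨a, hp, -⟩ := inv.last
    have hcp : (c, B) ∈ p := by rw [hp]; simp
    have hc := inv.box _ hcp
    obtain ⟨b, hb, -⟩ := append_cons_hseg a B c d
    rw [← hp] at hb
    rcases prudentStep_of_append hb hv with ⟨rfl, hs⟩ | ⟨rfl, hs⟩ | ⟨rfl, hs⟩ | ⟨rfl, hs⟩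
    · have hcd : c ≤ d := hs (c, B) (List.mem_append_left _ hcp) rfl
      rcases hd.lt_or_eq with hd | rfl
      · left
        simp only
        rw [List.append_assoc, ← hseg_add_one hcd]
        exact .bottom _ hr (by omega) (by omega)
      · exact Or.inr (Or.inr ⟨rfl, inv.neg.le⟩)
    · have hcd : d ≤ c := hs (c, B) (List.mem_append_left _ hcp) rfl
      left
      simp only
      rw [List.append_assoc, ← hseg_sub_one hcd]
      rcases (show L ≤ d - 1 by omega).lt_or_eq with hL | rfl
      · exact .bottom _ hr hL (by omega)
      · have := Prolonged.left B hr.bottom_left le_rfl (by simpa using hc.2.2.2)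
        rwa [vseg_self, List.append_nil] at this
    · obtain ⟨z, hz, h1, h2⟩ := inv.exists_above hL hd
      have := hs z (List.mem_append_left _ hz) h1
      simp only at this
      omega
    · left
      have := Prolonged.bottom d (hr.bottom_bottom d hL hd) hL hd
      rwa [hseg_self, List.append_nil] at this

theorem Prolonged.fst_nonpos {q : List Vertex} {e : Vertex} (h : Prolonged q e) : e.1 ≤ 0 := by
  cases h with
  | top d hr hL hd => exact hd
  | @left p c L B T d hr hB hd =>
    obtain ⟨a, hp, -⟩ := hr.leftInv.last
    exact (hr.leftInv.box (L, c) (by rw [hp]; simp)).2.1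
  | bottom d hr hL hd => exact hd

/-- The polygon in `𝓕` whose boundary walk until its top side is `p`. -/
def closeTop (p : List Vertex) (c T : ℤ) : List Vertex := p ++ hseg T c 1 ++ vseg 1 T 0

/-- The walk `q` has passed through `(1, T)` and then left the line of abscissa `1`, and the
part of this line below `(1, T)` can no longer be reached. -/
def Astray (q : List Vertex) : Prop :=
  ∃ q₀ r T, q = q₀ ++ r ∧ r ≠ [] ∧ (1, T) ∈ q₀ ∧
    ((∃ v ∈ q₀, v.1 < 0) ∨ ∀ j, 0 ≤ j → j ≤ T → ((0, j) : Vertex) ∈ q₀) ∧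
    ∀ v ∈ q, v.1 = 1 → T ≤ v.2

/-- Intermediate stages of the boundary walks of the polygons in `𝓕`. -/
def Stage (q : List Vertex) (e : Vertex) : Prop :=
  Prolonged q e ∨
  (∃ p c L B T j, RecordWalk .top p c L B T ∧ 1 ≤ j ∧ j ≤ T ∧ e = (1, j) ∧
    q = p ++ hseg T c 1 ++ vseg 1 T j) ∨
  Astray q

theorem TopInv.exists_row {p : List Vertex} {c L B T j : ℤ} (h : TopInv p c L B T) (h0 : 0 ≤ j)
    (hj : j ≤ T) : ∃ z ∈ p, z.2 = j := by
  obtain ⟨a, hp, -⟩ := h.last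
  exact exists_mem_snd_eq h.walk.chain h.walk.origin_mem
    (by rw [hp]; simp : ((c, T) : Vertex) ∈ p) h0 hj

/-- Suppose the walk came back to abscissa `1` below `T`. A step to the right would start at
abscissa `0`, from an interior point of the box or from a vertex visited before. A vertical step
would start either below `T` on this line or at `(1, T)`, which is used up. -/
theorem astray_step {q : List Vertex} {e v : Vertex} (h : Astray (q ++ [e]))
    (hw : IsPrudentWalk (q ++ [e] ++ [v])) (h1 : v.1 = 1 → 1 ≤ v.2)
    (h2 : e.1 ≤ 1) : Astray (q ++ [e] ++ [v]) := by
  obtain ⟨q₀, r, T, hq, hr, hT, hcase, hx⟩ := h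
  refine ⟨q₀, r ++ [v], T, by rw [hq, List.append_assoc], by simp, hT, hcase, ?_⟩
  obtain ⟨hw', hs⟩ := isPrudentWalk_concat.1 hw
  have her : e ∈ r := by
    obtain ⟨r', f, rfl⟩ := (List.eq_nil_or_concat' r).resolve_left hr
    rw [← List.append_assoc] at hq
    have := (List.append_inj' hq rfl).2
    simp at this
    simp [this]
  have hnd : ∀ z ∈ q₀, z ∈ r → False := by
    have := hw'.selfAvoiding
    rw [hq, List.nodup_append] at this
    exact fun z hz hz' => this.2.2 z hz z hz' rfl
  intro z hz hz1
  rcases List.mem_append.1 hz with hz | hz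
  · exact hx z hz hz1
  simp only [List.mem_singleton] at hz
  subst hz
  by_contra hlt
  have hpos := h1 hz1
  have he : e ∈ q ++ [e] := by simp
  rcases hs with ⟨h, -⟩ | ⟨h, -⟩ | ⟨h, -⟩ | ⟨h, -⟩
  · have e1 : z.1 = e.1 + 1 := by rw [h]
    have e2 : z.2 = e.2 := by rw [h]
    rcases hcase with ⟨y, hy, hy1⟩ | hall
    · have mem : ∀ y ∈ q₀, y ∈ q ++ [e] := fun y hy => by rw [hq]; exact List.mem_append_left _ hy
      exact hw'.not_interior ⟨y, mem y hy, by omega⟩ ⟨_, mem _ hT, by simp only; omega⟩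
        ⟨_, hw'.origin_mem, by simp only; omega⟩ ⟨_, mem _ hT, by simp only; omega⟩
    · refine hnd e ?_ her
      have := hall e.2 (by omega) (by omega)
      rwa [show ((0, e.2) : Vertex) = e from Prod.ext (by simp only; omega) rfl] at this
  · have e1 : z.1 = e.1 - 1 := by rw [h]
    omega
  · have e1 : z.1 = e.1 := by rw [h]
    have e2 : z.2 = e.2 + 1 := by rw [h]
    have := hx e he (by omega)
    omega
  · have e1 : z.1 = e.1 := by rw [h]
    have e2 : z.2 = e.2 - 1 := by rw [h]
    have := hx e he (by omega)
    exact hnd _ hT (by rwa [show ((1, T) : Vertex) = e from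
      Prod.ext (by simp only; omega) (by simp only; omega)])

theorem stage_step {q : List Vertex} {e v : Vertex} (h : Stage (q ++ [e]) e)
    (hw : IsPrudentWalk (q ++ [e] ++ [v])) (h1 : v.1 = 1 → 1 ≤ v.2)
    (h2 : v.1 ≤ 1) (h3 : e.1 ≤ 1) : Stage (q ++ [e] ++ [v]) v := by
  rcases h with h | ⟨p, c, L, B, T, j, hr, hj1, hjT, rfl, hq⟩ | h
  · rcases h.step hw with h | ⟨p, c, L, B, T, hr, hq, rfl⟩ | h
    · exact Or.inl h
    · refine Or.inr (Or.inl ⟨p, c, L, B, T, T, hr, hr.topInv.pos, le_rfl, rfl, ?_⟩)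
      obtain ⟨a, hp, -⟩ := hr.topInv.last
      have hc := (hr.topInv.box (c, T) (by rw [hp]; simp)).2.1
      rw [hq, vseg_self, List.append_nil, show (1 : ℤ) = 0 + 1 by norm_num, hseg_add_one hc,
        List.append_assoc]
    · omega
  · have inv := hr.topInv
    obtain ⟨hw', hs⟩ := isPrudentWalk_concat.1 hw
    have mem : ∀ z ∈ p, z ∈ q ++ [(1, j)] := fun z hz => by rw [hq]; simp [hz]
    obtain ⟨a, hp, -⟩ := inv.last
    have hc := (inv.box (c, T) (by rw [hp]; simp)).2.1
    simp only at hc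
    have hT : ((1, T) : Vertex) ∈ q ++ [(1, j)] := by
      rw [hq]
      refine List.mem_append_left _ (List.mem_append_right _ ?_)
      exact mem_hseg.2 ⟨rfl, Or.inl ⟨by simp only; omega, le_rfl⟩⟩
    rcases hs with ⟨rfl, hs⟩ | ⟨rfl, hs⟩ | ⟨rfl, hs⟩ | ⟨rfl, hs⟩
    · simp at h2
    · obtain ⟨z, hz, hzj⟩ := inv.exists_row (j := j) (by omega) hjT
      have h := hs z (mem z hz) hzj
      have := (inv.box z hz).2.1
      simp only at h
      omega
    -- Upwards is possible only at the corner `(1, T)`, since this corner stays above every later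
    -- vertex of the descent. Such a walk is astray from then on.
    · have hTj : T ≤ j := hs _ hT rfl
      obtain rfl : j = T := le_antisymm hjT hTj
      refine Or.inr (Or.inr ⟨q ++ [(1, j)], [(1, j + 1)], j, rfl, by simp, hT, ?_, ?_⟩)
      · by_cases hneg : ∃ v ∈ p, v.1 < 0
        · exact Or.inl (hneg.imp fun z hz => ⟨mem z hz.1, hz.2⟩)
        -- Without negative abscissas `p` lies on the line of abscissa `0`, and it meets all rows
        -- from `0` to `T`.
        · refine Or.inr fun i hi0 hij => ?_
          obtain ⟨z, hz, hzi⟩ := inv.exists_row hi0 hij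
          push Not at hneg
          have := hneg z hz
          have := (inv.box z hz).2.1
          rw [show ((0, i) : Vertex) = z from Prod.ext (by simp only; omega) hzi.symm]
          exact mem z hz
      · intro z hz hz1
        rcases List.mem_append.1 hz with hz | hz
        · rw [hq, vseg_self, List.append_nil] at hz
          rcases List.mem_append.1 hz with hz | hz
          · have := (inv.box z hz).2.1
            omega
          · exact (mem_hseg.1 hz).1.ge
        · simp at hz
          rw [hz]
          simp
    · have := h1 rfl
      simp only at this
      refine Or.inr (Or.inl ⟨p, c, L, B, T, j - 1, hr, this, by omega, rfl, ?_⟩)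
      rw [hq, vseg_sub_one hjT, ← List.append_assoc]
  · exact Or.inr (Or.inr (astray_step h hw h1 h3))

theorem IsPrudentWalk.of_prefix {a l : List Vertex} {e : Vertex} (hl : IsPrudentWalk l)
    (h : a ++ [e] <+: l) : IsPrudentWalk (a ++ [e]) := by
  obtain ⟨r, rfl⟩ := h
  induction r using List.reverseRecOn with
  | nil => simpa using hl
  | append_singleton r v ih =>
    apply ih
    rw [← List.append_assoc] at hl
    obtain ⟨b, f, hb⟩ := (List.eq_nil_or_concat' (a ++ [e] ++ r)).resolve_left (by simp)
    rw [hb] at hl ⊢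
    exact (isPrudentWalk_concat.1 hl).1

theorem stage_of_prefix {m : List Vertex} (hm : IsPrudentWalk m)
    (h1 : ∀ v ∈ m, v.1 = 1 → 1 ≤ v.2) (h2 : ∀ v ∈ m, v.1 ≤ 1) (q : List Vertex) (v : Vertex)
    (h : q ++ [v] <+: m) : Stage (q ++ [v]) v := by
  induction q using List.reverseRecOn generalizing v with
  | nil =>
    have := (hm.of_prefix h).start
    simp at this
    subst this
    have := Prolonged.left 0 .origin le_rfl one_pos
    rw [vseg_self, List.append_nil] at this
    exact Or.inl this
  | append_singleton q e ih =>
    exact stage_step (ih e ((List.prefix_append _ _).trans h)) (hm.of_prefix h)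
      (h1 v (h.subset (by simp))) (h2 v (h.subset (by simp))) (h2 e (h.subset (by simp)))

/-- Follow the stages up to `(1, 1)`: a prolonged record walk has not reached abscissa `1`, and an
astray walk would have to visit `(1, 1)` twice. Only the straight descent from the top row remains.
-/
theorem exists_recordWalk_of_mem_classF {l : List Vertex} (hl : l ∈ classF) :
    ∃ p c L B T, RecordWalk .top p c L B T ∧ l = closeTop p c T := by
  obtain ⟨⟨hw, -, -⟩, s, rfl⟩ := hl
  have hs : s ++ [(1, 1), (1, 0)] = s ++ [(1, 1)] ++ [((1, 0) : Vertex)] := by simp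
  rw [hs] at hw ⊢
  obtain ⟨hm, hstep⟩ := isPrudentWalk_concat.1 hw
  -- Prudence of the final step down from `(1, 1)`.
  have h1 : ∀ v ∈ s ++ [((1, 1) : Vertex)], v.1 = 1 → 1 ≤ v.2 := by
    rcases hstep with ⟨h, -⟩ | ⟨h, -⟩ | ⟨h, -⟩ | ⟨h, hs⟩
    · simp at h
    · simp at h
    · simp at h
    · exact hs
  -- A walk going beyond abscissa `1` would first cross this line strictly above `(1, 1)`. With the
  -- origin to the lower left, `(1, 1)` would then be an interior endpoint.
  have h2 : ∀ v ∈ s ++ [((1, 1) : Vertex)], v.1 ≤ 1 := by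
    intro v hv
    by_contra hlt
    have hvs : v ∈ s := by
      rcases List.mem_append.1 hv with hv | hv
      · exact hv
      · simp at hv; subst hv; simp at hlt
    obtain ⟨s₁, s₂, rfl⟩ := List.append_of_mem hvs
    have hpre : s₁ ++ [v] <+: s₁ ++ v :: s₂ ++ [(1, 1)] := ⟨s₂ ++ [(1, 1)], by simp⟩
    have hw₁ := hm.of_prefix hpre
    obtain ⟨z, hz, hz1⟩ := exists_mem_fst_eq hw₁.chain hw₁.origin_mem (by simp : v ∈ s₁ ++ [v])
      (j := 1) zero_le_one (by omega)
    have hz2 := h1 z (hpre.subset hz) hz1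
    have hne : z ≠ (1, 1) := by
      rintro rfl
      have := hm.selfAvoiding
      rw [show s₁ ++ v :: s₂ ++ [(1, 1)] = s₁ ++ [v] ++ (s₂ ++ [(1, 1)]) by simp,
        List.nodup_append] at this
      exact this.2.2 _ hz _ (by simp) rfl
    have : z.2 ≠ 1 := fun h => hne (Prod.ext hz1 h)
    exact hm.not_interior ⟨_, hm.origin_mem, by simp⟩ ⟨v, hv, by simp only; omega⟩
      ⟨_, hm.origin_mem, by simp⟩ ⟨z, hpre.subset hz, by simp only; omega⟩
  rcases stage_of_prefix hm h1 h2 s _ List.prefix_rfl with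
    h | ⟨p, c, L, B, T, j, hr, hj1, hjT, hj, hq⟩ | ⟨q₀, r, T, hq, hr, hT, -, hx⟩
  · have := h.fst_nonpos
    simp at this
  · obtain rfl : 1 = j := by simpa using hj
    refine ⟨p, c, L, B, T, hr, ?_⟩
    rw [hq, closeTop, show (0 : ℤ) = 1 - 1 by norm_num, vseg_sub_one hjT, ← List.append_assoc]
  · have hT1 : T ≤ 1 := hx (1, 1) (by simp) rfl
    have h1T : 1 ≤ T := h1 (1, T) (by rw [hq]; exact List.mem_append_left _ hT) rfl
    obtain rfl : T = 1 := le_antisymm hT1 h1T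
    have hmem : ((1, 1) : Vertex) ∈ r := by
      obtain ⟨r', f, rfl⟩ := (List.eq_nil_or_concat' r).resolve_left hr
      rw [← List.append_assoc] at hq
      have := (List.append_inj' hq rfl).2
      simp at this
      simp [this]
    have := hm.selfAvoiding
    rw [hq, List.nodup_append] at this
    exact absurd rfl (this.2.2 _ hT _ hmem)

/-! ### Box, top row and half-perimeter of a completed record walk -/

theorem foldr_min_eq {l : List ℤ} {a m : ℤ} (hl : ∀ z ∈ l, m ≤ z) (ha : m ≤ a)
    (hm : m = a ∨ m ∈ l) : l.foldr min a = m := by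
  induction l generalizing m with
  | nil => simpa [eq_comm] using hm
  | cons b l ih =>
    have hb := hl b (by simp)
    have hl' : ∀ z ∈ l, m ≤ z := fun z hz => hl z (by simp [hz])
    have hle : ∀ l : List ℤ, (∀ z ∈ l, m ≤ z) → m ≤ l.foldr min a := by
      intro l hl
      induction l with
      | nil => exact ha
      | cons b l ih => exact le_min (hl b (by simp)) (ih fun z hz => hl z (by simp [hz]))
    rw [List.foldr_cons]
    rcases hm with h | h
    · rw [ih hl' ha (Or.inl h), min_eq_right hb]
    · rcases List.mem_cons.1 h with rfl | h
      · exact min_eq_left (hle l hl')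
      · rw [ih hl' ha (Or.inr h), min_eq_right hb]

theorem foldr_max_eq {l : List ℤ} {a m : ℤ} (hl : ∀ z ∈ l, z ≤ m) (ha : a ≤ m)
    (hm : m = a ∨ m ∈ l) : l.foldr max a = m := by
  induction l generalizing m with
  | nil => simpa [eq_comm] using hm
  | cons b l ih =>
    have hb := hl b (by simp)
    have hl' : ∀ z ∈ l, z ≤ m := fun z hz => hl z (by simp [hz])
    have hle : ∀ l : List ℤ, (∀ z ∈ l, z ≤ m) → l.foldr max a ≤ m := by
      intro l hl
      induction l with
      | nil => exact ha
      | cons b l ih => exact max_le (hl b (by simp)) (ih fun z hz => hl z (by simp [hz]))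
    rw [List.foldr_cons]
    rcases hm with h | h
    · rw [ih hl' ha (Or.inl h), max_eq_right hb]
    · rcases List.mem_cons.1 h with rfl | h
      · exact max_eq_left (hle l hl')
      · rw [ih hl' ha (Or.inr h), max_eq_right hb]

theorem leftSide_eq {l : List Vertex} {m : ℤ} (hl : ∀ v ∈ l, m ≤ v.1) (h0 : m ≤ 0)
    (hm : ∃ v ∈ l, v.1 = m) : leftSide l = m :=
  foldr_min_eq (by simpa using fun a b h => hl (a, b) h) h0
    (Or.inr (by obtain ⟨v, hv, rfl⟩ := hm; exact List.mem_map_of_mem hv))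

theorem rightSide_eq {l : List Vertex} {m : ℤ} (hl : ∀ v ∈ l, v.1 ≤ m) (h0 : 0 ≤ m)
    (hm : ∃ v ∈ l, v.1 = m) : rightSide l = m :=
  foldr_max_eq (by simpa using fun a b h => hl (a, b) h) h0
    (Or.inr (by obtain ⟨v, hv, rfl⟩ := hm; exact List.mem_map_of_mem hv))

theorem bottomSide_eq {l : List Vertex} {m : ℤ} (hl : ∀ v ∈ l, m ≤ v.2) (h0 : m ≤ 0)
    (hm : ∃ v ∈ l, v.2 = m) : bottomSide l = m :=
  foldr_min_eq (by simpa using fun a b h => hl (b, a) h) h0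
    (Or.inr (by obtain ⟨v, hv, rfl⟩ := hm; exact List.mem_map_of_mem hv))

theorem topSide_eq {l : List Vertex} {m : ℤ} (hl : ∀ v ∈ l, v.2 ≤ m) (h0 : 0 ≤ m)
    (hm : ∃ v ∈ l, v.2 = m) : topSide l = m :=
  foldr_max_eq (by simpa using fun a b h => hl (b, a) h) h0
    (Or.inr (by obtain ⟨v, hv, rfl⟩ := hm; exact List.mem_map_of_mem hv))

theorem TopInv.mem_last {p : List Vertex} {c L B T : ℤ} (h : TopInv p c L B T) :
    ((c, T) : Vertex) ∈ p := by
  obtain ⟨a, rfl, -⟩ := h.last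
  simp

theorem TopInv.pos_nonpos {p : List Vertex} {c L B T : ℤ} (h : TopInv p c L B T) :
    c ≤ 0 := (h.box _ h.mem_last).2.1

theorem TopInv.le_pos {p : List Vertex} {c L B T : ℤ} (h : TopInv p c L B T) :
    L ≤ c := (h.box _ h.mem_last).1

theorem TopInv.sides {p : List Vertex} {c L B T : ℤ} (h : TopInv p c L B T) : L ≤ 0 ∧ B ≤ 0 := by
  have := h.box _ h.walk.origin_mem
  exact ⟨this.1, this.2.2.1⟩

theorem TopInv.mem_closeTop {p : List Vertex} {c L B T : ℤ} (h : TopInv p c L B T) {v : Vertex} :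
    v ∈ closeTop p c T ↔ v ∈ p ∨ (v.2 = T ∧ c < v.1 ∧ v.1 ≤ 1) ∨
      (v.1 = 1 ∧ 0 ≤ v.2 ∧ v.2 < T) := by
  have := h.pos_nonpos
  have := h.pos
  rw [closeTop, List.mem_append, List.mem_append, mem_hseg, mem_vseg, or_assoc]
  refine or_congr Iff.rfl ?_
  omega

theorem TopInv.topSide_closeTop {p : List Vertex} {c L B T : ℤ} (h : TopInv p c L B T) :
    topSide (closeTop p c T) = T := by
  refine topSide_eq (fun v hv => ?_) (by linarith [h.pos])
    ⟨_, h.mem_closeTop.2 (Or.inl h.mem_last), rfl⟩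
  rcases h.mem_closeTop.1 hv with hv | hv | hv
  · exact (h.box v hv).2.2.2
  · omega
  · omega

theorem TopInv.bottomSide_closeTop {p : List Vertex} {c L B T : ℤ} (h : TopInv p c L B T) :
    bottomSide (closeTop p c T) = B := by
  obtain ⟨b, hb, hb'⟩ := h.bottom_mem
  refine bottomSide_eq (fun v hv => ?_) h.sides.2 ⟨b, h.mem_closeTop.2 (Or.inl hb), hb'⟩
  have := h.sides.2
  have := h.pos
  rcases h.mem_closeTop.1 hv with hv | hv | hv
  · exact (h.box v hv).2.2.1
  · omega
  · omega

theorem TopInv.leftSide_closeTop {p : List Vertex} {c L B T : ℤ} (h : TopInv p c L B T) :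
    leftSide (closeTop p c T) = L := by
  obtain ⟨b, hb, hb', -⟩ := h.left_mem
  refine leftSide_eq (fun v hv => ?_) h.sides.1 ⟨b, h.mem_closeTop.2 (Or.inl hb), hb'⟩
  have := h.sides.1
  have := h.le_pos
  rcases h.mem_closeTop.1 hv with hv | hv | hv
  · exact (h.box v hv).1
  · omega
  · omega

theorem TopInv.rightSide_closeTop {p : List Vertex} {c L B T : ℤ} (h : TopInv p c L B T) :
    rightSide (closeTop p c T) = 1 := by
  have := h.pos
  refine rightSide_eq (fun v hv => ?_) zero_le_one
    ⟨(1, 0), h.mem_closeTop.2 (Or.inr (Or.inr ⟨rfl, le_rfl, by simp only; omega⟩)), rfl⟩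
  rcases h.mem_closeTop.1 hv with hv | hv | hv
  · linarith [(h.box v hv).2.1]
  · omega
  · omega

theorem TopInv.fst_eq {p : List Vertex} {c L B T : ℤ} (h : TopInv p c L B T)
    {v : Vertex} (hv : v ∈ p) (hvT : v.2 = T) : v.1 = c := by
  obtain ⟨a, rfl, ha⟩ := h.last
  rcases List.mem_append.1 hv with hv | hv
  · exact absurd hvT (ha v hv).ne
  · simp at hv
    rw [hv]

theorem TopInv.topRowLeft_closeTop {p : List Vertex} {c L B T : ℤ} (h : TopInv p c L B T) :
    topRowLeft (closeTop p c T) = c := by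
  rw [topRowLeft, h.topSide_closeTop, h.rightSide_closeTop]
  refine foldr_min_eq (fun z hz => ?_) (by linarith [h.pos_nonpos]) (Or.inr ?_)
  · simp only [List.mem_map, List.mem_filter, decide_eq_true_eq] at hz
    obtain ⟨v, ⟨hv, hvT⟩, rfl⟩ := hz
    rcases h.mem_closeTop.1 hv with hv | hv | hv
    · exact (h.fst_eq hv hvT).ge
    · omega
    · omega
  · simp only [List.mem_map, List.mem_filter, decide_eq_true_eq]
    exact ⟨_, ⟨h.mem_closeTop.2 (Or.inl h.mem_last), rfl⟩, rfl⟩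

theorem prefix_closeTop (p : List Vertex) (c T : ℤ) : p <+: closeTop p c T := by
  rw [closeTop, List.append_assoc]
  exact List.prefix_append _ _

theorem takeWhile_eq_of_prefix {P : Vertex → Bool} {a l : List Vertex} {e : Vertex}
    (hl : a ++ [e] <+: l) (ha : ∀ v ∈ a, P v = true) (he : P e = false) : l.takeWhile P = a := by
  obtain ⟨r, rfl⟩ := hl
  rw [List.append_assoc, List.takeWhile_append_of_pos ha, List.singleton_append,
    List.takeWhile_cons_of_neg (by simp [he]), List.append_nil]

theorem TopInv.untilTop_closeTop {p : List Vertex} {c L B T : ℤ} (h : TopInv p c L B T) :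
    untilTop (closeTop p c T) = p := by
  have hp := prefix_closeTop p c T
  rw [untilTop, h.topSide_closeTop, h.topRowLeft_closeTop]
  obtain ⟨a, ha, ha'⟩ := h.last
  have key : ∀ {l}, a ++ [(c, T)] <+: l → l.takeWhile (fun v => v.2 < T) ++ [(c, T)] = p :=
    fun hl => by
      rw [takeWhile_eq_of_prefix hl (fun v hv => by simpa using ha' v hv) (by simp), ha]
  exact key (by rwa [← ha])

theorem TopInv.length_closeTop {p : List Vertex} {c L B T : ℤ} (h : TopInv p c L B T) :
    ((closeTop p c T).length : ℤ) = p.length + 1 - c + T := by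
  have := h.pos_nonpos
  have := h.pos
  rw [closeTop, List.length_append, List.length_append, length_hseg, length_vseg]
  omega

/-- The parity invariant makes the division by two in `halfPerimeter` exact. -/
theorem TopInv.halfPerimeter_closeTop {p : List Vertex} {c L B T : ℤ} (h : TopInv p c L B T) :
    2 * (halfPerimeter (closeTop p c T) : ℤ) = p.length + 1 - c + T := by
  have := h.length_closeTop
  have := h.parity
  rw [halfPerimeter]
  omega

theorem TopInv.closeTop_mem_classF {p : List Vertex} {c L B T : ℤ} (h : TopInv p c L B T) :
    closeTop p c T ∈ classF := by
  have hc := h.pos_nonpos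
  have hT := h.pos
  have hlen := h.length_closeTop
  have hwalk : IsPrudentWalk (p ++ hseg T c 0 ++ [(1, T)]) := by
    obtain ⟨a, ha, ha'⟩ := h.last
    have := h.walk
    rw [ha] at this
    have := this.append_hseg (fun v hv => (ha' v hv).ne) 1
    rwa [show (1 : ℤ) = 0 + 1 by norm_num, hseg_add_one hc, ← ha, ← List.append_assoc] at this
  have hclose : closeTop p c T = p ++ hseg T c 0 ++ [(1, T)] ++ vseg 1 T 0 := by
    rw [closeTop, show (1 : ℤ) = 0 + 1 by norm_num, hseg_add_one hc, ← List.append_assoc]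
  have hx : ∀ v ∈ p ++ hseg T c 0, v.1 ≠ 1 := by
    intro v hv
    rcases List.mem_append.1 hv with hv | hv
    · have := (h.box v hv).2.1
      omega
    · rw [mem_hseg] at hv
      omega
  obtain ⟨b, hb, -⟩ := append_cons_vseg (p ++ hseg T c 0) 1 T 1
  have hb' : closeTop p c T = p ++ hseg T c 0 ++ b ++ [(1, 1), (1, 0)] := by
    rw [hclose, show (0 : ℤ) = 1 - 1 by norm_num, vseg_sub_one hT, ← List.append_assoc,
      show (1 : ℤ) - 1 = 0 by norm_num, hb]
    simp
  have hp : 0 < p.length := List.length_pos_of_mem h.mem_last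
  refine ⟨⟨?_, ⟨(1, 0), ?_, Or.inr (Or.inl (by simp))⟩, by omega⟩, ?_⟩
  · rw [hclose]
    exact hwalk.append_vseg hx 0
  · rw [hb']
    simp
  · rw [hb']
    exact List.suffix_append _ _

/-! ### A polygon determines its record walks -/

/-- `p` ends with its first vertex satisfying `P`. -/
def EndsAtFirst (P : Vertex → Prop) (p : List Vertex) : Prop :=
  ∃ a e, p = a ++ [e] ∧ P e ∧ ∀ v ∈ a, ¬ P v

theorem EndsAtFirst.eq {P : Vertex → Prop} {p q l : List Vertex} (hp : EndsAtFirst P p)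
    (hq : EndsAtFirst P q) (hpl : p <+: l) (hql : q <+: l) : p = q := by
  obtain ⟨a, e, rfl, he, ha⟩ := hp
  obtain ⟨b, f, rfl, hf, hb⟩ := hq
  rcases List.prefix_or_prefix_of_prefix hpl hql with h | h
  · rcases List.prefix_concat_iff.1 h with h | h
    · exact h
    · exact absurd he (hb e (h.subset (by simp)))
  · rcases List.prefix_concat_iff.1 h with h | h
    · exact h.symm
    · exact absurd hf (ha f (h.subset (by simp)))

/-- Both prefixes belong to one walk. The witness in `q` says that `P` occurs strictly before the
first `Q`, while the witness in `p` says that `Q` occurs no later than the first `P`. -/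
theorem EndsAtFirst.not_prefix {P Q : Vertex → Prop} {p q l : List Vertex} (hp : EndsAtFirst P p)
    (hq : EndsAtFirst Q q) (hpl : p <+: l) (hql : q <+: l) (h1 : ∃ v ∈ q, P v ∧ ¬ Q v)
    (h2 : ∃ v ∈ p, Q v) : False := by
  obtain ⟨y, hy, hyP, hyQ⟩ := h1
  obtain ⟨z, hz, hzQ⟩ := h2
  obtain ⟨b, f, rfl, hf, hb⟩ := hq
  have hyb : y ∈ b := by
    rcases List.mem_append.1 hy with hy | hy
    · exact hy
    · simp at hy
      exact absurd (hy ▸ hf) hyQ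
  obtain ⟨a, e, rfl, he, ha⟩ := hp
  have key : ¬ b ++ [f] <+: a ++ [e] := by
    intro h
    rcases List.prefix_concat_iff.1 h with h | h
    · have := (List.append_inj' h rfl).1
      exact ha y (this ▸ hyb) hyP
    · exact ha y (h.subset hy) hyP
  rcases List.prefix_or_prefix_of_prefix hpl hql with h | h
  · rcases List.prefix_concat_iff.1 h with h' | h'
    · exact key (by rw [h'])
    · exact hb z (h'.subset hz) hzQ
  · exact key h

theorem TopInv.endsAtFirst {p : List Vertex} {c L B T : ℤ} (h : TopInv p c L B T) :
    EndsAtFirst (fun v => T ≤ v.2) p := by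
  obtain ⟨a, ha, ha'⟩ := h.last
  exact ⟨a, _, ha, le_rfl, fun v hv => (ha' v hv).not_ge⟩

theorem LeftInv.endsAtFirst {p : List Vertex} {c L B T : ℤ} (h : LeftInv p c L B T) :
    EndsAtFirst (fun v => v.1 ≤ L) p := by
  obtain ⟨a, ha, ha'⟩ := h.last
  exact ⟨a, _, ha, le_rfl, fun v hv => (ha' v hv).not_ge⟩

theorem BottomInv.endsAtFirst {p : List Vertex} {c L B T : ℤ} (h : BottomInv p c L B T) :
    EndsAtFirst (fun v => v.2 ≤ B) p := by
  obtain ⟨a, ha, ha'⟩ := h.last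
  exact ⟨a, _, ha, le_rfl, fun v hv => (ha' v hv).not_ge⟩

/-- Record walks for a given side, together with their parameters. -/
@[ext]
structure Record (σ : Side) where
  walk : List Vertex
  pos : ℤ
  L : ℤ
  B : ℤ
  T : ℤ
  isRecord : RecordWalk σ walk pos L B T

/-- The parameters are functions of the walk: its last vertex gives the position and the side
reached, and the invariants say that the other sides of the box, up to a fixed shift by one, are
attained bounds of the walk. -/
theorem Record.ext_walk {σ : Side} {s s' : Record σ} (hw : s.walk = s'.walk) : s = s' := by
  obtain ⟨p, c, L, B, T, h⟩ := s
  obtain ⟨p', c', L', B', T', h'⟩ := s'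
  dsimp only at hw
  subst hw
  have inv := h.inv
  have inv' := h'.inv
  have key : ∀ v v' : Vertex, (∃ a, p = a ++ [v]) → (∃ a, p = a ++ [v']) → v = v' := by
    rintro v v' ⟨a, h⟩ ⟨a', h'⟩
    rw [h] at h'
    simpa using (List.append_inj' h' rfl).2
  suffices c = c' ∧ L = L' ∧ B = B' ∧ T = T' by
    obtain ⟨rfl, rfl, rfl, rfl⟩ := this
    rfl
  cases σ
  · obtain ⟨-, ⟨a, ha, -⟩, hbox, ⟨l, hl, hl', -⟩, ⟨b, hb, hb'⟩, -, -⟩ := inv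
    obtain ⟨-, ⟨a', ha', -⟩, hbox', ⟨m, hm, hm', -⟩, ⟨d, hd, hd'⟩, -, -⟩ := inv'
    have hcT := key _ _ ⟨a, ha⟩ ⟨a', ha'⟩
    rw [Prod.mk.injEq] at hcT
    have := hbox' l hl
    have := hbox' b hb
    have := hbox m hm
    have := hbox d hd
    omega
  · obtain ⟨-, ⟨a, ha, -⟩, hbox, ⟨l, hl, hl'⟩, ⟨b, hb, hb'⟩, -⟩ := inv
    obtain ⟨-, ⟨a', ha', -⟩, hbox', ⟨m, hm, hm'⟩, ⟨d, hd, hd'⟩, -⟩ := inv'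
    have hcL := key _ _ ⟨a, ha⟩ ⟨a', ha'⟩
    rw [Prod.mk.injEq] at hcL
    have := hbox' l hl
    have := hbox' b hb
    have := hbox m hm
    have := hbox d hd
    omega
  · obtain ⟨-, ⟨a, ha, -⟩, hbox, ⟨b, hb, hb'⟩, ⟨l, hl, hl', -⟩, -, -⟩ := inv
    obtain ⟨-, ⟨a', ha', -⟩, hbox', ⟨d, hd, hd'⟩, ⟨m, hm, hm', -⟩, -, -⟩ := inv'
    have hcB := key _ _ ⟨a, ha⟩ ⟨a', ha'⟩
    rw [Prod.mk.injEq] at hcB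
    have := hbox' l hl
    have := hbox' b hb
    have := hbox m hm
    have := hbox d hd
    omega

namespace Record

def topTop (s : Record .top) (d : ℤ) (hL : s.L ≤ d) (hd : d ≤ 0) : Record .top :=
  ⟨_, _, _, _, _, s.isRecord.top_top d hL hd⟩

def topLeft (s : Record .top) : Record .left := ⟨_, _, _, _, _, s.isRecord.top_left⟩

def leftTop (s : Record .left) : Record .top := ⟨_, _, _, _, _, s.isRecord.left_top⟩

def leftLeft (s : Record .left) (d : ℤ) (hB : s.B ≤ d) (hd : d < s.T) : Record .left :=
  ⟨_, _, _, _, _, s.isRecord.left_left d hB hd⟩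

def leftBottom (s : Record .left) : Record .bottom := ⟨_, _, _, _, _, s.isRecord.left_bottom⟩

def bottomBottom (s : Record .bottom) (d : ℤ) (hL : s.L < d) (hd : d ≤ 0) : Record .bottom :=
  ⟨_, _, _, _, _, s.isRecord.bottom_bottom d hL hd⟩

def bottomLeft (s : Record .bottom) : Record .left := ⟨_, _, _, _, _, s.isRecord.bottom_left⟩

def origin : Record .left := ⟨_, _, _, _, _, .origin⟩

/-- The polygon obtained by completing a record walk clockwise along the box. -/
def polygon : {σ : Side} → Record σ → List Vertex
  | .top, s => closeTop s.walk s.pos s.T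
  | .left, s => closeTop s.leftTop.walk s.leftTop.pos s.leftTop.T
  | .bottom, s => closeTop s.bottomLeft.leftTop.walk s.bottomLeft.leftTop.pos s.bottomLeft.leftTop.T

theorem polygon_leftTop (s : Record .left) : s.leftTop.polygon = s.polygon := rfl

theorem polygon_bottomLeft (s : Record .bottom) : s.bottomLeft.polygon = s.polygon := rfl

theorem prefix_polygon_top (s : Record .top) : s.walk <+: s.polygon :=
  prefix_closeTop _ _ _

theorem prefix_polygon_left (s : Record .left) : s.walk <+: s.polygon :=
  (List.prefix_append _ _).trans s.leftTop.prefix_polygon_top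

theorem prefix_polygon_bottom (s : Record .bottom) : s.walk <+: s.polygon :=
  (List.prefix_append _ _).trans s.bottomLeft.prefix_polygon_left

theorem topInv (s : Record .top) : TopInv s.walk s.pos s.L s.B s.T := s.isRecord.topInv

theorem leftInv (s : Record .left) : LeftInv s.walk s.pos s.L s.B s.T := s.isRecord.leftInv

theorem bottomInv (s : Record .bottom) : BottomInv s.walk s.pos s.L s.B s.T := s.isRecord.bottomInv

theorem polygon_mem_classF {σ : Side} (s : Record σ) : s.polygon ∈ classF := by
  cases σ
  · exact s.topInv.closeTop_mem_classF
  · exact s.leftTop.topInv.closeTop_mem_classF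
  · exact s.bottomLeft.leftTop.topInv.closeTop_mem_classF

theorem topSide_polygon {σ : Side} (s : Record σ) : topSide s.polygon = s.T := by
  cases σ
  · exact s.topInv.topSide_closeTop
  · exact s.leftTop.topInv.topSide_closeTop
  · exact s.bottomLeft.leftTop.topInv.topSide_closeTop

theorem leftSide_polygon {σ : Side} (s : Record σ) : leftSide s.polygon = s.L := by
  cases σ
  · exact s.topInv.leftSide_closeTop
  · exact s.leftTop.topInv.leftSide_closeTop
  · exact s.bottomLeft.leftTop.topInv.leftSide_closeTop

theorem bottomSide_polygon {σ : Side} (s : Record σ) : bottomSide s.polygon = s.B := by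
  cases σ
  · exact s.topInv.bottomSide_closeTop
  · exact s.leftTop.topInv.bottomSide_closeTop
  · exact s.bottomLeft.leftTop.topInv.bottomSide_closeTop

theorem rightSide_polygon {σ : Side} (s : Record σ) : rightSide s.polygon = 1 := by
  cases σ
  · exact s.topInv.rightSide_closeTop
  · exact s.leftTop.topInv.rightSide_closeTop
  · exact s.bottomLeft.leftTop.topInv.rightSide_closeTop

theorem top_eq_of_prefix {s s' : Record .top} {l : List Vertex} (h : s.walk <+: l)
    (h' : s'.walk <+: l) (hT : s.T = s'.T) : s = s' :=
  ext_walk (s.topInv.endsAtFirst.eq (hT ▸ s'.topInv.endsAtFirst) h h')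

theorem left_eq_of_prefix {s s' : Record .left} {l : List Vertex} (h : s.walk <+: l)
    (h' : s'.walk <+: l) (hL : s.L = s'.L) : s = s' :=
  ext_walk (s.leftInv.endsAtFirst.eq (hL ▸ s'.leftInv.endsAtFirst) h h')

theorem bottom_eq_of_prefix {s s' : Record .bottom} {l : List Vertex} (h : s.walk <+: l)
    (h' : s'.walk <+: l) (hB : s.B = s'.B) : s = s' :=
  ext_walk (s.bottomInv.endsAtFirst.eq (hB ▸ s'.bottomInv.endsAtFirst) h h')

theorem polygon_top_injective : Function.Injective (polygon (σ := .top)) := by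
  intro s s' h
  refine top_eq_of_prefix s.prefix_polygon_top (h ▸ s'.prefix_polygon_top) ?_
  rw [← topSide_polygon, h, topSide_polygon]

/-- Both left records are prefixes of the common polygon and end where it first reaches the common
left side. -/
theorem leftTop_injective : Function.Injective leftTop := by
  intro s s' h
  refine left_eq_of_prefix s.prefix_polygon_left ?_ (congr_arg (L (σ := .top)) h)
  rw [← polygon_leftTop, h]
  exact s'.prefix_polygon_left

theorem bottomLeft_injective : Function.Injective bottomLeft := by
  intro s s' h
  refine bottom_eq_of_prefix s.prefix_polygon_bottom ?_ (congr_arg (B (σ := .left)) h)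
  rw [← polygon_bottomLeft, h]
  exact s'.prefix_polygon_bottom

theorem polygon_injective {σ : Side} : Function.Injective (polygon (σ := σ)) := by
  cases σ
  · exact polygon_top_injective
  · exact polygon_top_injective.comp leftTop_injective
  · exact (polygon_top_injective.comp leftTop_injective).comp bottomLeft_injective

theorem range_polygon_top : Set.range (polygon (σ := .top)) = classF := by
  ext l
  constructor
  · rintro ⟨s, rfl⟩
    exact s.polygon_mem_classF
  · intro hl
    obtain ⟨p, c, L, B, T, hr, rfl⟩ := exists_recordWalk_of_mem_classF hl
    exact ⟨⟨p, c, L, B, T, hr⟩, rfl⟩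

end Record

/-! ### Parameters of the polygons and the last move of a record walk -/

namespace Record

theorem leftTop_length (s : Record .left) :
    (s.leftTop.walk.length : ℤ) = s.walk.length + (s.T - s.pos) := by
  obtain ⟨a, ha, -⟩ := s.leftInv.last
  have := s.leftInv.box (s.L, s.pos) (by rw [ha]; simp)
  simp only [leftTop, List.length_append, length_vseg]
  omega

theorem left_bounds (s : Record .left) : s.L ≤ 0 ∧ s.B ≤ 0 ∧ s.B ≤ s.pos ∧ s.pos < s.T := by
  obtain ⟨a, ha, -⟩ := s.leftInv.last
  have := s.leftInv.box (s.L, s.pos) (by rw [ha]; simp)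
  have := s.leftInv.box _ s.leftInv.walk.origin_mem
  omega

theorem top_bounds (s : Record .top) :
    s.L ≤ s.pos ∧ s.pos ≤ 0 ∧ s.B ≤ 0 ∧ 1 ≤ s.T :=
  ⟨s.topInv.le_pos, s.topInv.pos_nonpos, s.topInv.sides.2, s.topInv.pos⟩

theorem bottom_bounds (s : Record .bottom) :
    s.L < s.pos ∧ s.pos ≤ 0 ∧ s.B < 0 ∧ 1 ≤ s.T := by
  obtain ⟨a, ha, -⟩ := s.bottomInv.last
  have := s.bottomInv.box (s.pos, s.B) (by rw [ha]; simp)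
  have := s.bottomInv.box _ s.bottomInv.walk.origin_mem
  have := s.bottomInv.neg
  omega

theorem halfPerimeter_top (s : Record .top) :
    2 * (halfPerimeter s.polygon : ℤ) = s.walk.length + 1 - s.pos + s.T :=
  s.topInv.halfPerimeter_closeTop

theorem halfPerimeter_left (s : Record .left) :
    2 * (halfPerimeter s.polygon : ℤ) = s.walk.length + (s.T - s.pos) + 1 - s.L + s.T := by
  rw [← polygon_leftTop, halfPerimeter_top, leftTop_length]
  rfl

theorem halfPerimeter_bottom (s : Record .bottom) :
    2 * (halfPerimeter s.polygon : ℤ) =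
      s.walk.length + (s.pos - s.L) + (s.T - s.B) + 1 - s.L + s.T := by
  rw [← polygon_bottomLeft, halfPerimeter_left]
  have := s.bottom_bounds
  simp only [bottomLeft, List.length_append, length_hseg]
  omega

theorem topRowLeft_polygon (s : Record .top) : topRowLeft s.polygon = s.pos :=
  s.topInv.topRowLeft_closeTop

theorem untilTop_polygon (s : Record .top) : untilTop s.polygon = s.walk :=
  s.topInv.untilTop_closeTop

theorem mem_polygon_left (s : Record .left) {v : Vertex} :
    v ∈ s.polygon ↔ v ∈ s.walk ∨ (v.1 = s.L ∧ s.pos < v.2 ∧ v.2 ≤ s.T) ∨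
      (v.2 = s.T ∧ s.L < v.1 ∧ v.1 ≤ 1) ∨ (v.1 = 1 ∧ 0 ≤ v.2 ∧ v.2 < s.T) := by
  have hb := s.left_bounds
  have : v ∈ s.polygon ↔ _ := s.leftTop.topInv.mem_closeTop
  rw [this]
  simp only [leftTop, List.mem_append, mem_vseg, or_assoc]
  refine or_congr Iff.rfl ?_
  omega

theorem leftColumnBottom_polygon (s : Record .left) : leftColumnBottom s.polygon = s.pos := by
  have hb := s.left_bounds
  obtain ⟨a, ha, ha'⟩ := s.leftInv.last
  rw [leftColumnBottom, leftSide_polygon, topSide_polygon]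
  refine foldr_min_eq (fun z hz => ?_) hb.2.2.2.le (Or.inr ?_)
  · simp only [List.mem_map, List.mem_filter, decide_eq_true_eq] at hz
    obtain ⟨v, ⟨hv, hvL⟩, rfl⟩ := hz
    rcases s.mem_polygon_left.1 hv with hv | hv | hv | hv
    · rw [ha] at hv
      rcases List.mem_append.1 hv with hv | hv
      · exact absurd hvL (ha' v hv).ne'
      · simp at hv
        rw [hv]
    · omega
    · omega
    · omega
  · simp only [List.mem_map, List.mem_filter, decide_eq_true_eq]
    exact ⟨(s.L, s.pos), ⟨s.mem_polygon_left.2 (Or.inl (by rw [ha]; simp)), rfl⟩, rfl⟩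

theorem untilLeft_polygon (s : Record .left) : untilLeft s.polygon = s.walk := by
  have hp := s.prefix_polygon_left
  obtain ⟨a, ha, ha'⟩ := s.leftInv.last
  rw [untilLeft, leftSide_polygon, leftColumnBottom_polygon]
  rw [ha] at hp
  rw [takeWhile_eq_of_prefix hp (fun v hv => by simpa using ha' v hv) (by simp), ha]

theorem bottomRowRight_polygon (s : Record .bottom) : bottomRowRight s.polygon = s.pos := by
  have hb := s.bottom_bounds
  obtain ⟨a, ha, ha'⟩ := s.bottomInv.last
  rw [bottomRowRight, leftSide_polygon, bottomSide_polygon]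
  refine foldr_max_eq (fun z hz => ?_) hb.1.le (Or.inr ?_)
  · simp only [List.mem_map, List.mem_filter, decide_eq_true_eq] at hz
    obtain ⟨v, ⟨hv, hvB⟩, rfl⟩ := hz
    rcases s.bottomLeft.mem_polygon_left.1 hv with hv | hv | hv | hv
    · rcases List.mem_append.1 hv with hv | hv
      · rw [ha] at hv
        rcases List.mem_append.1 hv with hv | hv
        · exact absurd hvB (ha' v hv).ne'
        · simp at hv
          rw [hv]
      · rw [mem_hseg] at hv
        omega
    all_goals
      simp only [bottomLeft] at hv
      omega
  · simp only [List.mem_map, List.mem_filter, decide_eq_true_eq]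
    exact ⟨(s.pos, s.B), ⟨s.prefix_polygon_bottom.subset (by rw [ha]; simp), rfl⟩, rfl⟩

theorem top_cases (s : Record .top) :
    (∃ s' d hL hd, topTop s' d hL hd = s) ∨ ∃ s', leftTop s' = s := by
  obtain ⟨p, c, L, B, T, h⟩ := s
  cases h with
  | top_top d h hL hd => exact Or.inl ⟨⟨_, _, _, _, _, h⟩, _, hL, hd, rfl⟩
  | left_top h => exact Or.inr ⟨⟨_, _, _, _, _, h⟩, rfl⟩

theorem left_cases (s : Record .left) :
    (∃ s' d hB hd, leftLeft s' d hB hd = s) ∨ origin = s ∨ (∃ s', topLeft s' = s) ∨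
      ∃ s', bottomLeft s' = s := by
  obtain ⟨p, c, L, B, T, h⟩ := s
  cases h with
  | left_left d h hB hd => exact Or.inl ⟨⟨_, _, _, _, _, h⟩, _, hB, hd, rfl⟩
  | origin => exact Or.inr (Or.inl rfl)
  | top_left h => exact Or.inr (Or.inr (Or.inl ⟨⟨_, _, _, _, _, h⟩, rfl⟩))
  | bottom_left h => exact Or.inr (Or.inr (Or.inr ⟨⟨_, _, _, _, _, h⟩, rfl⟩))

theorem bottom_cases (s : Record .bottom) :
    (∃ s' d hL hd, bottomBottom s' d hL hd = s) ∨ ∃ s', leftBottom s' = s := by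
  obtain ⟨p, c, L, B, T, h⟩ := s
  cases h with
  | bottom_bottom d h hL hd => exact Or.inl ⟨⟨_, _, _, _, _, h⟩, _, hL, hd, rfl⟩
  | left_bottom h => exact Or.inr ⟨⟨_, _, _, _, _, h⟩, rfl⟩

/-- A walk cannot reach both the next side to the left before the last row, and the last row before
this side. -/
theorem top_left_absurd {s : Record .top} {s' : Record .left} {l : List Vertex}
    (h : s.walk <+: l) (h' : s'.walk <+: l) (hL : s.L = s'.L) (hT : s.T + 1 = s'.T) : False := by
  obtain ⟨v, hv, h1, h2⟩ := s.topInv.left_mem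
  obtain ⟨z, hz, hz'⟩ := s'.leftInv.top_mem
  exact s'.leftInv.endsAtFirst.not_prefix s.topInv.endsAtFirst h' h ⟨v, hv, by omega, by omega⟩
    ⟨z, hz, by omega⟩

/-- The bottom record has visited the left side of `s` above its bottom line, whereas `s` reaches
this bottom line no later than its own left side. -/
theorem left_bottom_absurd {s : Record .left} {s' : Record .bottom} {l : List Vertex}
    (h : s.walk <+: l) (h' : s'.walk <+: l) (hL : s.L = s'.L + 1) (hB : s.B = s'.B) : False := by
  obtain ⟨v, hv, h1, h2⟩ := s'.bottomInv.left_mem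
  obtain ⟨z, hz, hz'⟩ := s.leftInv.bottom_mem
  exact s.leftInv.endsAtFirst.not_prefix s'.bottomInv.endsAtFirst h h' ⟨v, hv, by omega, by omega⟩
    ⟨z, hz, by omega⟩

theorem prefix_topTop (s : Record .top) (d : ℤ) (hL : s.L ≤ d) (hd : d ≤ 0) :
    s.walk <+: (s.topTop d hL hd).walk :=
  (List.prefix_append _ _).trans (List.prefix_append _ _)

theorem prefix_topLeft (s : Record .top) : s.walk <+: s.topLeft.walk := List.prefix_append _ _

theorem prefix_leftTop (s : Record .left) : s.walk <+: s.leftTop.walk := List.prefix_append _ _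

theorem prefix_leftLeft (s : Record .left) (d : ℤ) (hB : s.B ≤ d) (hd : d < s.T) :
    s.walk <+: (s.leftLeft d hB hd).walk :=
  (List.prefix_append _ _).trans (List.prefix_append _ _)

theorem prefix_leftBottom (s : Record .left) : s.walk <+: s.leftBottom.walk :=
  List.prefix_append _ _

theorem prefix_bottomBottom (s : Record .bottom) (d : ℤ) (hL : s.L < d) (hd : d ≤ 0) :
    s.walk <+: (s.bottomBottom d hL hd).walk :=
  (List.prefix_append _ _).trans (List.prefix_append _ _)

theorem prefix_bottomLeft (s : Record .bottom) : s.walk <+: s.bottomLeft.walk :=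
  List.prefix_append _ _

end Record

/-! ### Left and bottom records enumerate `classG` and `classH` -/

/-- A piece attached on top of `k` has begun in the walk `p`, for a polygon with box `L`, `B`, `T`
to be completed. -/
def HasBase (p : List Vertex) (L B T : ℤ) : Prop :=
  ∃ k, (k ∈ classF ∨ k = rootEdge) ∧ untilTop k <+: p ∧ T = topSide k + 1 ∧ L ≤ leftSide k - 1 ∧
    B ≤ bottomSide k

theorem HasBase.mono {p p' : List Vertex} {L L' B B' T : ℤ} (h : HasBase p L B T) (hp : p <+: p')
    (hL : L' ≤ L) (hB : B' ≤ B) : HasBase p' L' B' T := by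
  obtain ⟨k, hk, h1, h2, h3, h4⟩ := h
  exact ⟨k, hk, h1.trans hp, h2, by omega, by omega⟩

theorem hasBase_rootEdge {p : List Vertex} {L B : ℤ} (hp : [(0, 0)] <+: p) (hL : L < 0)
    (hB : B ≤ 0) : HasBase p L B 1 := by
  refine ⟨rootEdge, Or.inr rfl, ?_, rfl, ?_, ?_⟩
  · exact hp
  · change L ≤ 0 - 1
    omega
  · exact hB

/-- The base is created when the top left corner is passed, or it is the root edge if the walk has
moved on from the origin without doing so. Later moves among left and bottom records do not change
`T` and only enlarge the box to the left or below, so the base survives. -/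
theorem RecordWalk.hasBase {σ : Side} {p : List Vertex} {c L B T : ℤ}
    (h : RecordWalk σ p c L B T) :
    (σ = .left → (p = [(0, 0)] ∧ L = 0 ∧ B = 0 ∧ T = 1) ∨ HasBase p L B T) ∧
      (σ = .bottom → HasBase p L B T) := by
  induction h with
  | origin => simp
  | top_top | left_top => simp
  | @top_left p c L B T h =>
    refine ⟨fun _ => Or.inr ⟨closeTop p c T, Or.inl h.topInv.closeTop_mem_classF, ?_, ?_, ?_, ?_⟩,
      by simp⟩
    · rw [h.topInv.untilTop_closeTop]
      exact List.prefix_append _ _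
    · rw [h.topInv.topSide_closeTop]
    · rw [h.topInv.leftSide_closeTop]
    · rw [h.topInv.bottomSide_closeTop]
  | left_left d h hB hd ih =>
    refine ⟨fun _ => Or.inr ?_, by simp⟩
    rw [List.append_assoc]
    rcases ih.1 rfl with ⟨rfl, rfl, rfl, rfl⟩ | ih
    · exact hasBase_rootEdge (List.prefix_append _ _) (by omega) le_rfl
    · exact ih.mono (List.prefix_append _ _) (by omega) le_rfl
  | left_bottom h ih =>
    refine ⟨by simp, fun _ => ?_⟩
    rcases ih.1 rfl with ⟨rfl, rfl, rfl, rfl⟩ | ih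
    · exact hasBase_rootEdge (List.prefix_append _ _) (by omega) (by omega)
    · exact ih.mono (List.prefix_append _ _) (by omega) (by omega)
  | bottom_bottom d h hL hd ih =>
    refine ⟨by simp, fun _ => ?_⟩
    rw [List.append_assoc]
    exact (ih.2 rfl).mono (List.prefix_append _ _) le_rfl (by omega)
  | bottom_left h ih =>
    exact ⟨fun _ => Or.inr ((ih.2 rfl).mono (List.prefix_append _ _) le_rfl le_rfl), by simp⟩

/-- The witness is the left record from which the walk turned the bottom left corner; further bottom
records only lower `B`. -/
theorem RecordWalk.exists_left {σ : Side} {p : List Vertex} {c L B T : ℤ}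
    (h : RecordWalk σ p c L B T) : σ = .bottom → ∃ s : Record .left, s.walk <+: p ∧
      L = s.L - 1 ∧ B ≤ s.B - 1 ∧ T = s.T := by
  induction h with
  | left_bottom h =>
    exact fun _ => ⟨⟨_, _, _, _, _, h⟩, List.prefix_append _ _, rfl, le_rfl, rfl⟩
  | bottom_bottom d h hL hd ih =>
    intro hσ
    obtain ⟨s, h1, h2, h3, h4⟩ := ih hσ
    rw [List.append_assoc]
    exact ⟨s, h1.trans (List.prefix_append _ _), h2, by omega, h4⟩
  | _ => simp

namespace Record

theorem polygon_origin : origin.polygon = unitSquare := by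
  decide

/-- A polygon in `classF` is a left record exactly if its top side is first reached at the left side
of the box. The shift of the left side demanded in `classG` is what excludes a last move along the
top. -/
theorem range_polygon_left : Set.range (polygon (σ := .left)) = classG := by
  ext l
  constructor
  · rintro ⟨s, rfl⟩
    refine ⟨s.polygon_mem_classF, ?_⟩
    rcases s.isRecord.hasBase.1 rfl with ⟨h, -⟩ | ⟨k, hk, h1, h2, h3, h4⟩
    · left
      rw [← polygon_origin, show s = origin from ext_walk h]
    · refine Or.inr ⟨k, hk, h1.trans s.prefix_polygon_left, ?_, ?_, ?_⟩
      · rw [topSide_polygon, h2]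
      · rwa [leftSide_polygon]
      · rwa [bottomSide_polygon]
  · rintro ⟨hl, rfl | ⟨k, hk, h1, h2, h3, h4⟩⟩
    · exact ⟨origin, polygon_origin⟩
    rw [← range_polygon_top] at hl
    obtain ⟨s, rfl⟩ := hl
    rcases s.top_cases with ⟨s', d, hL, hd, rfl⟩ | ⟨s', rfl⟩
    -- If the last move was along the top, then `s'` is the only top record one level lower in this
    -- polygon, so it would be the base; but its left side has not been shifted. The root edge is
    -- too low to be the base.
    · exfalso
      rw [topSide_polygon] at h2
      rw [leftSide_polygon] at h3
      have hT : topSide k = s'.T := by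
        simp only [topTop] at h2
        omega
      rcases hk with hk | rfl
      · rw [← range_polygon_top] at hk
        obtain ⟨s₀, rfl⟩ := hk
        rw [topSide_polygon] at hT
        rw [AttachedOnTop, untilTop_polygon] at h1
        rw [top_eq_of_prefix h1 ((s'.prefix_topTop d hL hd).trans (prefix_polygon_top _)) hT,
          leftSide_polygon] at h3
        simp only [topTop] at h3
        omega
      · have := s'.top_bounds
        rw [← hT] at this
        exact absurd this.2.2.2 (by decide)
    · exact ⟨s', rfl⟩

theorem range_polygon_bottom : Set.range (polygon (σ := .bottom)) = classH := by
  ext l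
  constructor
  · rintro ⟨s, rfl⟩
    refine ⟨range_polygon_left ▸ ⟨s.bottomLeft, rfl⟩, ?_⟩
    obtain ⟨s', h1, h2, h3, h4⟩ := s.isRecord.exists_left rfl
    refine ⟨s'.polygon, range_polygon_left ▸ ⟨s', rfl⟩, ?_, ?_, ?_, ?_⟩
    · rw [AttachedOnLeft, untilLeft_polygon]
      exact h1.trans s.prefix_polygon_bottom
    · rwa [leftSide_polygon, leftSide_polygon]
    · rwa [bottomSide_polygon, bottomSide_polygon]
    · rwa [topSide_polygon, topSide_polygon]
  · rintro ⟨hl, k, hk, h1, h2, h3, h4⟩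
    rw [← range_polygon_left] at hl hk
    obtain ⟨s, rfl⟩ := hl
    obtain ⟨s₀, rfl⟩ := hk
    rw [AttachedOnLeft, untilLeft_polygon] at h1
    rw [leftSide_polygon, leftSide_polygon] at h2
    rw [bottomSide_polygon, bottomSide_polygon] at h3
    rw [topSide_polygon, topSide_polygon] at h4
    -- Only the last case survives. In the first, `s₀ = s'` and the bottom side has not moved; the
    -- origin leaves no room for a left shift; and in the third, `s₀` would attain its left side
    -- both after and before the row `s'.T`.
    rcases s.left_cases with ⟨s', d, hB, hd, rfl⟩ | rfl | ⟨s', rfl⟩ | ⟨s', rfl⟩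
    · exfalso
      simp only [leftLeft] at h2 h3
      rw [left_eq_of_prefix h1 ((s'.prefix_leftLeft d hB hd).trans (prefix_polygon_left _))
        (by omega)] at h3
      omega
    · have := s₀.left_bounds
      simp only [origin] at h2
      omega
    · simp only [topLeft] at h2 h4
      exact (top_left_absurd (s'.prefix_topLeft.trans (prefix_polygon_left _)) h1 (by omega)
        h4).elim
    · exact ⟨s', rfl⟩

/-! ### Uniqueness of the last move -/

theorem topTop_inj {s s' : Record .top} {d d' : ℤ} {hL : s.L ≤ d} {hd : d ≤ 0} {hL' : s'.L ≤ d'}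
    {hd' : d' ≤ 0} (h : s.topTop d hL hd = s'.topTop d' hL' hd') : s = s' ∧ d = d' := by
  have hT : s.T + 1 = s'.T + 1 := congr_arg (Record.T (σ := .top)) h
  exact ⟨top_eq_of_prefix (s.prefix_topTop d hL hd) (h ▸ s'.prefix_topTop d' hL' hd') (by omega),
    congr_arg (Record.pos (σ := .top)) h⟩

theorem leftLeft_inj {s s' : Record .left} {d d' : ℤ} {hB : s.B ≤ d} {hd : d < s.T}
    {hB' : s'.B ≤ d'} {hd' : d' < s'.T} (h : s.leftLeft d hB hd = s'.leftLeft d' hB' hd') :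
    s = s' ∧ d = d' := by
  have hL : s.L - 1 = s'.L - 1 := congr_arg (Record.L (σ := .left)) h
  exact ⟨left_eq_of_prefix (s.prefix_leftLeft d hB hd) (h ▸ s'.prefix_leftLeft d' hB' hd')
    (by omega), congr_arg (Record.pos (σ := .left)) h⟩

theorem bottomBottom_inj {s s' : Record .bottom} {d d' : ℤ} {hL : s.L < d} {hd : d ≤ 0}
    {hL' : s'.L < d'} {hd' : d' ≤ 0} (h : s.bottomBottom d hL hd = s'.bottomBottom d' hL' hd') :
    s = s' ∧ d = d' := by
  have hB : s.B - 1 = s'.B - 1 := congr_arg (Record.B (σ := .bottom)) h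
  exact ⟨bottom_eq_of_prefix (s.prefix_bottomBottom d hL hd)
    (h ▸ s'.prefix_bottomBottom d' hL' hd') (by omega), congr_arg (Record.pos (σ := .bottom)) h⟩

theorem topLeft_injective : Function.Injective topLeft := by
  intro s s' h
  have hT : s.T + 1 = s'.T + 1 := congr_arg (Record.T (σ := .left)) h
  exact top_eq_of_prefix s.prefix_topLeft (h ▸ s'.prefix_topLeft) (by omega)

theorem leftBottom_injective : Function.Injective leftBottom := by
  intro s s' h
  have hL : s.L - 1 = s'.L - 1 := congr_arg (Record.L (σ := .bottom)) h
  exact left_eq_of_prefix s.prefix_leftBottom (h ▸ s'.prefix_leftBottom) (by omega)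

theorem topTop_ne_leftTop (s : Record .top) (d : ℤ) (hL : s.L ≤ d) (hd : d ≤ 0)
    (s' : Record .left) : s.topTop d hL hd ≠ s'.leftTop := fun h =>
  top_left_absurd (s.prefix_topTop d hL hd) (h ▸ s'.prefix_leftTop)
    (congr_arg (Record.L (σ := .top)) h) (congr_arg (Record.T (σ := .top)) h)

theorem bottomBottom_ne_leftBottom (s : Record .bottom) (d : ℤ) (hL : s.L < d) (hd : d ≤ 0)
    (s' : Record .left) : s.bottomBottom d hL hd ≠ s'.leftBottom := fun h => by
  have h1 : s.L = s'.L - 1 := congr_arg (Record.L (σ := .bottom)) h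
  have h2 : s.B - 1 = s'.B - 1 := congr_arg (Record.B (σ := .bottom)) h
  exact left_bottom_absurd s'.prefix_leftBottom (h ▸ s.prefix_bottomBottom d hL hd) (by omega)
    (by omega)

theorem leftLeft_ne_topLeft (s : Record .left) (d : ℤ) (hB : s.B ≤ d) (hd : d < s.T)
    (s' : Record .top) : s.leftLeft d hB hd ≠ s'.topLeft := fun h => by
  have h1 : s.L - 1 = s'.L - 1 := congr_arg (Record.L (σ := .left)) h
  have h2 : s.T = s'.T + 1 := congr_arg (Record.T (σ := .left)) h
  exact top_left_absurd s'.prefix_topLeft (h ▸ s.prefix_leftLeft d hB hd) (by omega) (by omega)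

theorem leftLeft_ne_bottomLeft (s : Record .left) (d : ℤ) (hB : s.B ≤ d) (hd : d < s.T)
    (s' : Record .bottom) : s.leftLeft d hB hd ≠ s'.bottomLeft := fun h => by
  have h1 : s.L - 1 = s'.L := congr_arg (Record.L (σ := .left)) h
  have h2 : s.B = s'.B := congr_arg (Record.B (σ := .left)) h
  exact left_bottom_absurd (s.prefix_leftLeft d hB hd) (h ▸ s'.prefix_bottomLeft) (by omega)
    (by omega)

theorem leftLeft_ne_origin (s : Record .left) (d : ℤ) (hB : s.B ≤ d) (hd : d < s.T) :
    s.leftLeft d hB hd ≠ origin := fun h => by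
  have h1 : s.L - 1 = 0 := congr_arg (Record.L (σ := .left)) h
  have := s.left_bounds
  omega

theorem topLeft_ne_origin (s : Record .top) : s.topLeft ≠ origin := fun h => by
  have h1 : s.L - 1 = 0 := congr_arg (Record.L (σ := .left)) h
  have := s.top_bounds
  omega

theorem bottomLeft_ne_origin (s : Record .bottom) : s.bottomLeft ≠ origin := fun h => by
  have h1 : s.B = 0 := congr_arg (Record.B (σ := .left)) h
  have := s.bottom_bounds
  omega

theorem topLeft_ne_bottomLeft (s : Record .top) (s' : Record .bottom) :
    s.topLeft ≠ s'.bottomLeft := fun h => by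
  have h1 : s.T = s'.B := congr_arg (Record.pos (σ := .left)) h
  have := s.top_bounds
  have := s'.bottom_bounds
  omega

end Record

/-! ### Finiteness, and the generating functions as sums over records -/

theorem finite_isPrudentWalk (n : ℕ) : {l | IsPrudentWalk l ∧ l.length ≤ n}.Finite := by
  induction n with
  | zero =>
    refine Set.Finite.subset (Set.finite_singleton []) fun l hl => ?_
    simpa using hl.2
  | succ n ih =>
    -- A walk with more than one vertex is given by a shorter walk and one of four directions; the
    -- default value for the empty list plays no role.
    have hfin := (ih.prod (Set.toFinite ({(1, 0), (-1, 0), (0, 1), (0, -1)} : Set Vertex))).image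
      fun q => q.1 ++ [q.1.getLast?.getD (0, 0) + q.2]
    refine ((Set.finite_singleton [(0, 0)]).union hfin).subset ?_
    rintro l ⟨hl, hn⟩
    rcases List.eq_nil_or_concat' l with rfl | ⟨a, v, rfl⟩
    · have := hl.start
      simp at this
    rcases List.eq_nil_or_concat' a with rfl | ⟨a, e, rfl⟩
    · have := hl.start
      simp at this
      simp [this]
    · right
      obtain ⟨h1, h2, -⟩ := isPrudentWalk_concat_iff.1 hl
      refine ⟨(a ++ [e], v - e), ⟨⟨h1, by simp at hn ⊢; omega⟩, h2⟩, ?_⟩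
      simp

theorem finite_halfPerimeter (σ : Side) (N : ℕ) :
    {s : Record σ | halfPerimeter s.polygon = N}.Finite := by
  -- The bound `2 * N + 1` allows for rounding in `halfPerimeter`, so parity is not needed here.
  refine Set.Finite.preimage (Record.polygon_injective.injOn)
    (s := {l | IsPrudentWalk l ∧ l.length ≤ 2 * N + 1}) (finite_isPrudentWalk _) |>.subset ?_
  intro s hs
  refine ⟨s.polygon_mem_classF.1.walk, ?_⟩
  simp only [Set.mem_ofPred_eq, halfPerimeter] at hs
  omega

theorem hasSum_genFun {S : Type*} {C : Set (List Vertex)} {a b c : List Vertex → ℤ}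
    (f : S → List Vertex) (hf : Function.Injective f) (hC : Set.range f = C) {n a' b' c' : S → ℕ}
    (hfin : ∀ N, {s | n s = N}.Finite) (hn : ∀ s, halfPerimeter (f s) = n s)
    (ha : ∀ s, a (f s) = a' s) (hb : ∀ s, b (f s) = b' s) (hc : ∀ s, c (f s) = c' s) :
    HasSum (fun s => weight u w x (n s) (a' s) (b' s) (c' s)) (genFun C a b c) := by
  refine hasSum_weight hfin fun m => ?_
  rw [genFun, ← Set.ncard_image_of_injective _ hf]
  congr 2
  ext l
  subst hC
  constructor
  · rintro ⟨⟨s, rfl⟩, h⟩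
    rw [hn, ha, hb, hc, Nat.cast_inj, Nat.cast_inj, Nat.cast_inj] at h
    exact ⟨s, h, rfl⟩
  · rintro ⟨s, h, rfl⟩
    refine ⟨⟨s, rfl⟩, ?_⟩
    rw [hn, ha, hb, hc, Nat.cast_inj, Nat.cast_inj, Nat.cast_inj]
    exact h

namespace Record

theorem hasSum_F : HasSum (fun s : Record .top => weight u w x (halfPerimeter s.polygon)
    (1 - s.pos).toNat (s.pos - s.L).toNat (s.T - s.B).toNat) F := by
  refine hasSum_genFun polygon polygon_injective range_polygon_top (finite_halfPerimeter _)
    (fun s => rfl) (fun s => ?_) (fun s => ?_) fun s => ?_ <;> have := s.top_bounds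
  · rw [rightSide_polygon, topRowLeft_polygon]
    omega
  · rw [leftSide_polygon, topRowLeft_polygon]
    omega
  · rw [boxHeight, topSide_polygon, bottomSide_polygon]
    omega

theorem hasSum_G : HasSum (fun s : Record .left => weight u w x (halfPerimeter s.polygon)
    (s.T - s.pos).toNat (s.pos - s.B).toNat (1 - s.L).toNat) G := by
  refine hasSum_genFun polygon polygon_injective range_polygon_left (finite_halfPerimeter _)
    (fun s => rfl) (fun s => ?_) (fun s => ?_) fun s => ?_ <;> have := s.left_bounds
  · rw [topSide_polygon, leftColumnBottom_polygon]
    omega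
  · rw [bottomSide_polygon, leftColumnBottom_polygon]
    omega
  · rw [boxWidth, rightSide_polygon, leftSide_polygon]
    omega

theorem hasSum_H : HasSum (fun s : Record .bottom => weight u w x (halfPerimeter s.polygon)
    (s.pos - s.L).toNat (-s.pos).toNat (s.T - s.B).toNat) H := by
  refine hasSum_genFun polygon polygon_injective range_polygon_bottom (finite_halfPerimeter _)
    (fun s => rfl) (fun s => ?_) (fun s => ?_) fun s => ?_ <;> have := s.bottom_bounds
  · rw [leftSide_polygon, bottomRowRight_polygon]
    omega
  · rw [rightSide_polygon, bottomRowRight_polygon]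
    omega
  · rw [boxHeight, topSide_polygon, bottomSide_polygon]
    omega

/-! ### The three functional equations -/

/-- Adding a row of length `i + 1` on top. -/
def stepTop (q : Σ s : Record .top, Fin ((1 - s.pos).toNat + (s.pos - s.L).toNat)) : Record .top :=
  -- The right side of the box is `1`, so a row starting at `-i` has length `i + 1`.
  q.1.topTop (-q.2) (by have := q.1.top_bounds; have := q.2.2; omega) (by omega)

/-- Adding a column of length `i + 1` on the left. -/
def stepLeft (q : Σ s : Record .left, Fin ((s.T - s.pos).toNat + (s.pos - s.B).toNat)) :
    Record .left :=
  q.1.leftLeft (q.1.T - 1 - q.2) (by have := q.1.left_bounds; have := q.2.2; omega) (by omega)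

/-- Adding a row of length `i + 1` on the bottom. -/
def stepBottom (q : Σ s : Record .bottom, Fin ((s.pos - s.L).toNat + (-s.pos).toNat)) :
    Record .bottom :=
  -- The bottom row extends from `L` to its right corner, hence the shift by one.
  q.1.bottomBottom (q.1.L + 1 + q.2) (by omega)
    (by have := q.1.bottom_bounds; have := q.2.2; omega)

theorem stepTop_bijective : Function.Bijective (Sum.elim stepTop leftTop) := by
  constructor
  · rintro (⟨s, i⟩ | s) (⟨s', i'⟩ | s') h
    · simp only [Sum.elim_inl, stepTop] at h
      obtain ⟨rfl, h⟩ := topTop_inj h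
      obtain rfl : i = i' := Fin.ext (by omega)
      rfl
    · simp only [Sum.elim_inl, Sum.elim_inr, stepTop] at h
      exact (topTop_ne_leftTop _ _ _ _ _ h).elim
    · simp only [Sum.elim_inl, Sum.elim_inr, stepTop] at h
      exact (topTop_ne_leftTop _ _ _ _ _ h.symm).elim
    · rw [leftTop_injective h]
  · intro s
    rcases s.top_cases with ⟨s', d, hL, hd, rfl⟩ | ⟨s', rfl⟩
    · have := s'.top_bounds
      refine ⟨Sum.inl ⟨s', ⟨(-d).toNat, by omega⟩⟩, ?_⟩
      simp only [Sum.elim_inl, stepTop]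
      congr
      omega
    · exact ⟨Sum.inr s', rfl⟩

theorem stepBottom_bijective : Function.Bijective (Sum.elim stepBottom leftBottom) := by
  constructor
  · rintro (⟨s, i⟩ | s) (⟨s', i'⟩ | s') h
    · simp only [Sum.elim_inl, stepBottom] at h
      obtain ⟨rfl, h⟩ := bottomBottom_inj h
      obtain rfl : i = i' := Fin.ext (by omega)
      rfl
    · simp only [Sum.elim_inl, Sum.elim_inr, stepBottom] at h
      exact (bottomBottom_ne_leftBottom _ _ _ _ _ h).elim
    · simp only [Sum.elim_inl, Sum.elim_inr, stepBottom] at h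
      exact (bottomBottom_ne_leftBottom _ _ _ _ _ h.symm).elim
    · rw [leftBottom_injective h]
  · intro s
    rcases s.bottom_cases with ⟨s', d, hL, hd, rfl⟩ | ⟨s', rfl⟩
    · have := s'.bottom_bounds
      refine ⟨Sum.inl ⟨s', ⟨(d - s'.L - 1).toNat, by omega⟩⟩, ?_⟩
      simp only [Sum.elim_inl, stepBottom]
      congr
      omega
    · exact ⟨Sum.inr s', rfl⟩

/-- The polygons in `𝓖` whose leftmost column has no predecessor. -/
def initLeft : (Unit ⊕ Record .top) ⊕ Record .bottom → Record .left :=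
  Sum.elim (Sum.elim (fun _ => origin) topLeft) bottomLeft

theorem initLeft_injective : Function.Injective initLeft := by
  rintro ((_ | s) | s) ((_ | s') | s') h
  · rfl
  · exact (s'.topLeft_ne_origin h.symm).elim
  · exact (s'.bottomLeft_ne_origin h.symm).elim
  · exact (s.topLeft_ne_origin h).elim
  · rw [topLeft_injective h]
  · exact (s.topLeft_ne_bottomLeft s' h).elim
  · exact (s.bottomLeft_ne_origin h).elim
  · exact (s'.topLeft_ne_bottomLeft s h.symm).elim
  · rw [bottomLeft_injective h]

theorem stepLeft_bijective : Function.Bijective (Sum.elim stepLeft initLeft) := by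
  have hne : ∀ q r, stepLeft q ≠ initLeft r := by
    rintro q ((_ | s) | s) <;> unfold stepLeft
    · exact leftLeft_ne_origin _ _ _ _
    · exact leftLeft_ne_topLeft _ _ _ _ _
    · exact leftLeft_ne_bottomLeft _ _ _ _ _
  constructor
  · rintro (⟨s, i⟩ | r) (⟨s', i'⟩ | r') h
    · simp only [Sum.elim_inl, stepLeft] at h
      obtain ⟨rfl, h⟩ := leftLeft_inj h
      obtain rfl : i = i' := Fin.ext (by omega)
      rfl
    · exact (hne _ _ h).elim
    · exact (hne _ _ h.symm).elim
    · rw [initLeft_injective h]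
  · intro s
    rcases s.left_cases with ⟨s', d, hL, hd, rfl⟩ | rfl | ⟨s', rfl⟩ | ⟨s', rfl⟩
    · have := s'.left_bounds
      refine ⟨Sum.inl ⟨s', ⟨(s'.T - 1 - d).toNat, by omega⟩⟩, ?_⟩
      simp only [Sum.elim_inl, stepLeft]
      congr
      omega
    · exact ⟨Sum.inr (Sum.inl (Sum.inl ())), rfl⟩
    · exact ⟨Sum.inr (Sum.inl (Sum.inr s')), rfl⟩
    · exact ⟨Sum.inr (Sum.inr s'), rfl⟩

/-- The initial objects are left records regarded as top records. The polygon is the same, but now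
its top row is the full width of the box, so `u` takes over the width and `x` the height, which is
the sum of the two exponents in `G`. -/
theorem functionalEquation_F : FunctionalEquation F (eval G x x u) := by
  refine functionalEquation_of_bijective (finite_halfPerimeter _) hasSum_F stepTop leftTop
    stepTop_bijective (fun s i => ?_) ?_
  · have hb := s.top_bounds
    have h := s.halfPerimeter_top
    have h' := (stepTop ⟨s, i⟩).halfPerimeter_top
    have hi := i.2
    simp only [stepTop, topTop, List.length_append, length_hseg, List.length_singleton] at h' ⊢
    omega
  · refine hasSum_of_eq (hasSum_eval hasSum_G constantCoeff_x constantCoeff_x constantCoeff_u)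
      fun s => ?_
    have hb := s.left_bounds
    rw [polygon_leftTop]
    simp only [leftTop, weight]
    rw [show (s.T - s.B).toNat = (s.T - s.pos).toNat + (s.pos - s.B).toNat by omega,
      show (s.L - s.L).toNat = 0 by omega]
    ring

theorem functionalEquation_G : FunctionalEquation G
    (t ^ 2 * u * x + t ^ 2 * u * x * eval F x (x * t) w + x * eval H x x u) := by
  have hxt : constantCoeff (x * t) = 0 := by rw [map_mul, constantCoeff_x, zero_mul]
  refine functionalEquation_of_bijective (finite_halfPerimeter _) hasSum_G stepLeft initLeft
    stepLeft_bijective (fun s i => ?_) ?_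
  · have hb := s.left_bounds
    have h := s.halfPerimeter_left
    have h' := (stepLeft ⟨s, i⟩).halfPerimeter_left
    have hi := i.2
    simp only [stepLeft, leftLeft, List.length_append, length_vseg, List.length_singleton] at h' ⊢
    omega
  · refine HasSum.sum (HasSum.sum ?_ ?_) ?_
    · refine hasSum_of_eq (hasSum_unique fun _ : Unit => t ^ 2 * u * x) fun _ => ?_
      change _ = weight u w x (halfPerimeter origin.polygon) _ _ _
      rw [polygon_origin]
      -- Half-perimeter `2`, leftmost column of length `1` at the bottom of the box, width `1`.
      change _ = weight u w x 2 1 0 1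
      rw [weight]
      ring
    · refine hasSum_of_eq ((hasSum_eval hasSum_F constantCoeff_x hxt constantCoeff_w).mul_left
        (t ^ 2 * u * x)) fun s => ?_
      change _ = weight u w x (halfPerimeter s.topLeft.polygon) (s.topLeft.T - s.topLeft.pos).toNat
        (s.topLeft.pos - s.topLeft.B).toNat (1 - s.topLeft.L).toNat
      have hb := s.top_bounds
      -- Passing the top left corner adds one row and one column, hence `t ^ 2`; the way from the
      -- top row to the left side is traversed outwards and back, which is why `w` becomes `x * t`
      -- in `F`.
      have hn : halfPerimeter s.topLeft.polygon =
          halfPerimeter s.polygon + 2 + (s.pos - s.L).toNat := by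
        have h := s.halfPerimeter_top
        have h' := s.topLeft.halfPerimeter_left
        generalize halfPerimeter s.topLeft.polygon = N at h' ⊢
        simp only [topLeft, List.length_append, length_hseg] at h'
        omega
      rw [hn]
      simp only [topLeft]
      rw [show (s.T + 1 - s.T).toNat = 1 by omega,
        show (1 - (s.L - 1)).toNat = 1 + (1 - s.pos).toNat + (s.pos - s.L).toNat by omega]
      simp only [weight]
      ring
    · refine hasSum_of_eq ((hasSum_eval hasSum_H constantCoeff_x constantCoeff_x
        constantCoeff_u).mul_left x) fun s => ?_
      change _ = weight u w x (halfPerimeter s.polygon) (s.T - s.B).toNat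
        (s.B - s.B).toNat (1 - s.L).toNat
      have hb := s.bottom_bounds
      rw [show (s.B - s.B).toNat = 0 by omega,
        show (1 - s.L).toNat = 1 + (s.pos - s.L).toNat + (-s.pos).toNat by omega]
      simp only [weight]
      ring

/-- The width of a polygon in `classG` is at least one, so `G x (x * t) w` is divisible by `w` term
by term. The division matches the convention that `w` marks the distance minus one in `H`: the new
bottom row has length one in a box that is one unit wider, which leaves the old width minus one. -/
theorem functionalEquation_H : ∃ J : Series, w * J = eval G x (x * t) w ∧
    FunctionalEquation H (t ^ 2 * u * x * J) := by
  have hxt : constantCoeff (x * t) = 0 := by rw [map_mul, constantCoeff_x, zero_mul]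
  obtain ⟨J, hJ⟩ := summable_t_pow_mul (finite_halfPerimeter .left) fun s =>
    x ^ (s.T - s.pos).toNat * (x * t) ^ (s.pos - s.B).toNat * w ^ (-s.L).toNat
  refine ⟨J, ?_, ?_⟩
  · refine (hJ.mul_left w).unique ?_
    refine hasSum_of_eq (hasSum_eval hasSum_G constantCoeff_x hxt constantCoeff_w) fun s => ?_
    have hb := s.left_bounds
    rw [show (1 - s.L).toNat = 1 + (-s.L).toNat by omega, weight]
    ring
  refine functionalEquation_of_bijective (finite_halfPerimeter _) hasSum_H stepBottom leftBottom
    stepBottom_bijective (fun s i => ?_) ?_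
  · have hb := s.bottom_bounds
    have h := s.halfPerimeter_bottom
    have h' := (stepBottom ⟨s, i⟩).halfPerimeter_bottom
    have hi := i.2
    simp only [stepBottom, bottomBottom, List.length_append, length_hseg,
      List.length_singleton] at h' ⊢
    omega
  · refine hasSum_of_eq (hJ.mul_left (t ^ 2 * u * x)) fun s => ?_
    have hb := s.left_bounds
    -- As at the top left corner: one more column and one more row, and the descent from the
    -- column's lower end to the old bottom side is paid twice.
    have hn : halfPerimeter s.leftBottom.polygon =
        halfPerimeter s.polygon + 2 + (s.pos - s.B).toNat := by
      have h := s.halfPerimeter_left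
      have h' := s.leftBottom.halfPerimeter_bottom
      generalize halfPerimeter s.leftBottom.polygon = N at h' ⊢
      simp only [leftBottom, List.length_append, length_vseg] at h'
      omega
    rw [hn]
    simp only [leftBottom]
    rw [show (s.L - (s.L - 1)).toNat = 1 by omega,
      show (s.T - (s.B - 1)).toNat = 1 + (s.T - s.pos).toNat + (s.pos - s.B).toNat by omega]
    simp only [weight]
    ring

end Record

end Prudent

theorem mainTheorem6 :
    Prudent.FunctionalEquation Prudent.F
      (Prudent.eval Prudent.G Prudent.x Prudent.x Prudent.u) ∧
    Prudent.FunctionalEquation Prudent.G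
      (Prudent.t ^ 2 * Prudent.u * Prudent.x
        + Prudent.t ^ 2 * Prudent.u * Prudent.x
            * Prudent.eval Prudent.F Prudent.x (Prudent.x * Prudent.t) Prudent.w
        + Prudent.x * Prudent.eval Prudent.H Prudent.x Prudent.x Prudent.u) ∧
    ∃ J : Prudent.Series,
      Prudent.w * J = Prudent.eval Prudent.G Prudent.x (Prudent.x * Prudent.t) Prudent.w ∧
      Prudent.FunctionalEquation Prudent.H
        (Prudent.t ^ 2 * Prudent.u * Prudent.x * J) :=
  ⟨Prudent.Record.functionalEquation_F, Prudent.Record.functionalEquation_G,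
    Prudent.Record.functionalEquation_H⟩
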